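/- **Conventions.** A *knotoid diagram* in $S^2$ is a generic immersion of $[0,1]$ in the oriented sphere $S^2$ with over/under information at each double point and with distinct endpoints, the image of $0$ being the *head* and the image of $1$ the *leg*; it is oriented from head to leg. A *knotoid* is a class of such diagrams modulo isotopy of $S^2$ and the three Reidemeister moves performed in discs disjoint from the head and the leg. The mirror $\mathrm{mir}(\kappa)$ of a knotoid is obtained by switching all crossings. The product $\kappa\kappa'$ is obtained by joining the leg of a diagram of $\kappa$ to the head of a diagram of $\kappa'$: a disc neighbourhood of that leg and a disc neighbourhood of that head, each meeting its diagram in a radius, are removed, and the two spheres are glued along the boundary circles so that the curves match. The empty product is the trivial knotoid. Let $R_3=\mathbb{Z}/3\mathbb{Z}$ be the dihedral quandle, $x^y=2y-x$, which acts on itself by $y*x=y^x=2x-y$. Let $D$ be a knotoid diagram. Its *arcs* run from under-passage to under-passage (or from the head, or to the leg), its *regions* are the components of $S^2\setminus D$, and the normal of an oriented arc points to its left. An $(R_3,R_3)$-*coloring* of $D$ assigns an element of $R_3$ to each arc and to each region such that * at each crossing with over-arc colored $y$, if the normal of the over-arc points from the under-arc colored $x$ to the under-arc colored $z$, then $z=x^y$;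 * along each edge of $D$, if the normal of the edge points from a region colored $r$ to a region colored $r'$, and the edge lies on an arc colored $a$, then $r'=r*a$; in particular $r*a=r$ for the region with color $r$ around the head or the leg and the color $a$ of the arc ending there. The number of these colorings is $col_{(R_3,R_3)}(D)$. Let $2_1$ be the knotoid with the two-crossing diagram on which one passes, from head to leg, under a first crossing, over a second crossing, over the first crossing and under the second crossing, both crossings having the same sign. (There are two such diagrams, one for each sign, which are reflections of each other in a line; the statement holds for either of them.) **Theorem.** The shadow coloring number distinguishes infinitely many knotoids from their mirrors: there are infinitely many knotoids $\kappa$ in $S^2$ for which there are integers $m\ne m'$ such that $col_{(R_3,R_3)}(D)=m$ for every diagram $D$ of $\kappa$ and $col_{(R_3,R_3)}(D')=m'$ for every diagram $D'$ of $\mathrm{mir}(\kappa)$. Concretely, for all $n\ge 0$, every diagram $D$ of $\prod_{i=1}^n 2_1$ and every diagram $D'$ of $\prod_{i=1}^n\mathrm{mir}(2_1)$, $$col_{(R_3,R_3)}(D)=3,\qquad col_{(R_3,R_3)}(D')=3^{n+1}.$$ Moreover $\mathrm{mir}\left(\prod_{i=1}^n 2_1\right)=\prod_{i=1}^n\mathrm{mir}(2_1)$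 for all $n\ge 0$; this knotoid differs from $\prod_{i=1}^n 2_1$ when $n\ge1$; and the knotoids $\prod_{i=1}^n 2_1$, $n\ge 0$, are pairwise different. -/

import Mathlib

/-! ### Knotoid diagrams in the 2-sphere

A generic immersion of an interval has connected image, so a knotoid diagram in the oriented
sphere is determined, up to orientation-preserving homeomorphism (that is, up to isotopy of the
sphere), by its signed Gauss code: travel along the diagram from the head to the leg and record, at
every passage through a crossing, the crossing, whether one passes over or under, and the sign of
the crossing. A signed Gauss code describes a diagram whose regions are discs in a closed
oriented surface; that surface is the sphere iff its Euler characteristic is `2`. -/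

/-- One passage of the curve through a crossing: the name of the crossing, whether the passage is
the over-passage, and whether the crossing is positive. -/
@[ext] structure Pass where
  label : ℕ
  isOver : Bool
  isPos : Bool

namespace Pass

/-- The other passage through the same crossing. -/
def swap (p : Pass) : Pass := ⟨p.label, !p.isOver, p.isPos⟩

/-- The same passage after the crossing has been switched (so that its sign changes as well). -/
def mirror (p : Pass) : Pass := ⟨p.label, !p.isOver, !p.isPos⟩

/-- Renaming of crossings. -/
def relabel (f : ℕ → ℕ) (p : Pass) : Pass := ⟨f p.label, p.isOver, p.isPos⟩

end Pass

/-- A word of passages. The passages are numbered `0, …, m - 1`, the edges `0, …, m`; passage `i`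
leads from edge `i` to edge `i + 1`. Edge `0` contains the head and edge `m` contains the leg. -/
abbrev GaussCode := List Pass

namespace GaussCode

/-- Every crossing that occurs is passed exactly twice, once over and once under, with a
well-defined sign. -/
def IsValid (w : GaussCode) : Prop :=
  w.Nodup ∧ (∀ p ∈ w, p.swap ∈ w) ∧ ∀ p ∈ w, ∀ q ∈ w, p.label = q.label → p.isPos = q.isPos

/-- The edges of the diagram: the pieces into which the curve is cut by the crossings. -/
abbrev Edge (w : GaussCode) := Fin (w.length + 1)

/-- A side of an edge; `true` is the left side and `false` the right side, with respect to the
direction of travel. -/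
abbrev Side (w : GaussCode) := w.Edge × Bool

/-- Passages `i` and `j` go through the same crossing, and the strand of `j` crosses the strand
of `i` from right to left. At a positive crossing `i` is the over-passage, at a negative
crossing it is the under-passage. -/
def Crosses (w : GaussCode) (i j : Fin w.length) : Prop :=
  w[i].label = w[j].label ∧ w[i].isOver = w[i].isPos ∧ w[j].isOver ≠ w[j].isPos

/-- The four corners at a crossing: two sides which meet in a corner bound the same region. Draw
the strand of `i` from south-west to north-east and the strand of `j` from south-east to
north-west. -/
inductive Corner (w : GaussCode) : w.Side → w.Side → Prop
  | north (i j : Fin w.length) : w.Crosses i j → Corner w (i.succ, true) (j.succ, false)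
  | west (i j : Fin w.length) : w.Crosses i j → Corner w (j.succ, true) (i.castSucc, true)
  | south (i j : Fin w.length) : w.Crosses i j → Corner w (i.castSucc, false) (j.castSucc, true)
  | east (i j : Fin w.length) : w.Crosses i j → Corner w (j.castSucc, false) (i.succ, false)

/-- Two sides of edges that bound the same region because they meet in a corner at a crossing,
or because they are the two sides of the edge ending at the head or at the leg. -/
inductive RegionRel (w : GaussCode) : w.Side → w.Side → Prop
  | corner (a b : w.Side) : w.Corner a b → RegionRel w a b
  | head : RegionRel w (0, true) (0, false)
  | leg : RegionRel w (Fin.last _, true) (Fin.last _, false)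

/-- The regions of the diagram: the classes of sides under the equivalence relation generated by
`RegionRel`. -/
def Region (w : GaussCode) := Quot w.RegionRel

/-- The region on the given side of the given edge. -/
def region (w : GaussCode) (e : w.Edge) (s : Bool) : w.Region := Quot.mk _ (e, s)

/-- The surface of the diagram has Euler characteristic `2`. With `n` crossings the code has length
`2 * n`, and the diagram has `n + 2` vertices (crossings, head and leg) and `2 * n + 1` edges. So
the condition says that there are `n + 1` regions. -/
def IsSpherical (w : GaussCode) : Prop := 2 * Nat.card w.Region = w.length + 2

/-- Consecutive edges belong to the same arc when the passage between them is an over-passage. -/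
inductive ArcRel (w : GaussCode) : w.Edge → w.Edge → Prop
  | overpass (i : Fin w.length) : w[i].isOver = true → ArcRel w i.castSucc i.succ

/-- The arcs of the diagram: the maximal pieces of the curve that run from under-passage to
under-passage (or start at the head, or end at the leg). -/
def Arc (w : GaussCode) := Quot w.ArcRel

/-- The arc containing the given edge. -/
def arc (w : GaussCode) (e : w.Edge) : w.Arc := Quot.mk _ e

/-- Switching all crossings. -/
def mirror (w : GaussCode) : GaussCode := w.map Pass.mirror

/-- Concatenation, after the crossings of the two factors have been given different names. -/
def mul (u v : GaussCode) : GaussCode :=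
  u.map (Pass.relabel fun k => 2 * k) ++ v.map (Pass.relabel fun k => 2 * k + 1)

/-- The two passages `a`, `b` in this order, or in the opposite order. -/
def seg (p : Bool) (a b : Pass) : GaussCode := if p then [a, b] else [b, a]

/-- Renaming of crossings, and the three Reidemeister moves, performed in a disc that is disjoint
from the head and the leg.
* `r1` introduces a kink.
* `r2` pulls a strand across another one. The two strands run in the same direction along the
  bigon iff `d`. The edges involved have to border a common region, on the sides on which they
  face each other. One gets all cases of the move by varying `o` (whether the first strand is the
  over-strand), the sign `s` of the first crossing on the first strand, and `d`.
* `r3` moves a strand across a crossing. The strands are top, middle and bottom, and the crossings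
  are `x` (top over middle), `y` (top over bottom) and `z` (middle over bottom), with signs `a`,
  `b`, `c`. The top strand passes `x` before `y` iff `p`, the middle one passes `x` before `z`
  iff `q`, the bottom one passes `y` before `z` iff `r`. The two equations say that three
  oriented lines in the plane in general position realize these signs and these orders, so that
  the three crossings are the vertices of a triangular region. The three strands may occur along the
  curve in any order. -/
inductive Move : GaussCode → GaussCode → Prop
  | relabel (w : GaussCode) (f : Equiv.Perm ℕ) : Move w (w.map (Pass.relabel f))
  | r1 (A B : GaussCode) (k : ℕ) (o s : Bool) :
      Move (A ++ B) (A ++ [⟨k, o, s⟩, ⟨k, !o, s⟩] ++ B)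
  | r2 (A B C : GaussCode) (k l : ℕ) (o s d : Bool) (e f : (A ++ B ++ C).Edge)
      (he : (e : ℕ) = A.length) (hf : (f : ℕ) = A.length + B.length)
      (h : (A ++ B ++ C).region e (d != (o == s)) = (A ++ B ++ C).region f (o == s)) :
      Move (A ++ B ++ C)
        (A ++ [⟨k, o, s⟩, ⟨l, o, !s⟩] ++ B ++ seg d ⟨k, !o, s⟩ ⟨l, !o, !s⟩ ++ C)
  | r3 (A B C E S₁ S₂ S₃ : GaussCode) (x y z : ℕ) (a b c p q r : Bool)
      (h₁ : (q == a) = (r == b)) (h₂ : (p == a) = (r == c))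
      (hS : [S₁, S₂, S₃].Perm
        [seg p ⟨x, true, a⟩ ⟨y, true, b⟩, seg q ⟨x, false, a⟩ ⟨z, true, c⟩,
          seg r ⟨y, false, b⟩ ⟨z, false, c⟩]) :
      Move (A ++ S₁ ++ B ++ S₂ ++ C ++ S₃ ++ E)
        (A ++ S₁.reverse ++ B ++ S₂.reverse ++ C ++ S₃.reverse ++ E)

/-! #### Facts needed to see that mirrors and products of spherical diagrams are spherical -/

/-- The passages of `w` numbered `k, k + 1, …` are those of `u`, transformed by `g`; and `g`
respects the incidence of passages and crossings. -/
structure Emb (g : Pass → Pass) (k : ℕ) (u w : GaussCode) : Prop where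
  le : k + u.length ≤ w.length
  get : ∀ i : Fin u.length, w[k + i.1]'(by have := i.2; omega) = g u[i]
  label : ∀ p q, (g p).label = (g q).label ↔ p.label = q.label
  pos : ∀ p, (g p).isOver = (g p).isPos ↔ p.isOver = p.isPos

variable {g : Pass → Pass} {k : ℕ} {u v w : GaussCode}

/-- The passage of `w` corresponding to a passage of `u`. -/
def Emb.ix (h : Emb g k u w) (i : Fin u.length) : Fin w.length :=
  ⟨k + i, by have := h.le; omega⟩

/-- The side in `w` corresponding to a side in `u`. -/
def Emb.side (h : Emb g k u w) (x : u.Side) : w.Side :=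
  (⟨k + x.1, by have := h.le; omega⟩, x.2)

lemma Emb.crosses (h : Emb g k u w) (i j : Fin u.length) :
    w.Crosses (h.ix i) (h.ix j) ↔ u.Crosses i j := by
  have hi : w[h.ix i] = g u[i] := h.get i
  have hj : w[h.ix j] = g u[j] := h.get j
  unfold Crosses
  rw [hi, hj, h.label, h.pos, ne_eq, h.pos]

lemma Emb.corner (h : Emb g k u w) {a b : u.Side} (hab : u.Corner a b) :
    w.Corner (h.side a) (h.side b) := by
  cases hab with
  | north i j hc => exact .north _ _ ((h.crosses i j).2 hc)
  | west i j hc => exact .west _ _ ((h.crosses i j).2 hc)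
  | south i j hc => exact .south _ _ ((h.crosses i j).2 hc)
  | east i j hc => exact .east _ _ ((h.crosses i j).2 hc)

/-- If two-valued labels of the sides agree at all corners, then the two ends of the curve are alike. -/
lemma sum_ends (hu : u.IsValid) (f : u.Side → ZMod 2)
    (hf : ∀ a b, u.Corner a b → f a = f b) :
    f (0, true) + f (0, false) = f (Fin.last _, true) + f (Fin.last _, false) := by
  set G : u.Edge → ZMod 2 := fun e => f (e, true) + f (e, false) with hG
  have two : ∀ x : ZMod 2, x + x = 0 := by decide
  have hp : ∀ i : Fin u.length, ∃ j : Fin u.length, u[j] = u[i].swap := by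
    intro i
    obtain ⟨n, hn, h⟩ := List.getElem_of_mem (hu.2.1 u[i] (List.getElem_mem _))
    exact ⟨⟨n, hn⟩, h⟩
  choose π hπ using hp
  have hinj : ∀ i j : Fin u.length, u[i] = u[j] → i = j := fun i j h =>
    Fin.ext ((List.Nodup.getElem_inj_iff hu.1).1 h)
  have key : ∀ i j, u.Crosses i j →
      (G i.castSucc + G i.succ) + (G j.castSucc + G j.succ) = 0 := by
    intro i j h
    have hn := hf _ _ (.north i j h)
    have hw := hf _ _ (.west i j h)
    have hs := hf _ _ (.south i j h)
    have he := hf _ _ (.east i j h)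
    simp only [hG]
    rw [hn, hw, hs, ← he]
    linear_combination two (f (i.castSucc, true)) + two (f (j.castSucc, true)) +
      two (f (j.castSucc, false)) + two (f (j.succ, false))
  have hsum : ∑ i : Fin u.length, (G i.castSucc + G i.succ) = 0 := by
    refine Finset.sum_involution (fun i _ => π i) ?_ ?_ (fun _ _ => Finset.mem_univ _) ?_
    · intro i _
      have h := hπ i
      by_cases hc : u[i].isOver = u[i].isPos
      · refine key i (π i) ⟨by rw [h]; rfl, hc, ?_⟩
        rw [h]; simp only [Pass.swap]; rw [hc]; cases u[i].isPos <;> decide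
      · rw [add_comm]
        refine key (π i) i ⟨by rw [h]; rfl, ?_, hc⟩
        rw [h]; simp only [Pass.swap]
        revert hc; cases u[i].isPos <;> cases u[i].isOver <;> decide
    · intro i _ _ h
      have h2 := hπ i
      rw [h] at h2
      have := congrArg Pass.isOver h2
      simp [Pass.swap] at this
    · intro i _
      apply hinj
      rw [hπ, hπ]
      simp [Pass.swap]
  rw [Finset.sum_add_distrib] at hsum
  have h1 := Fin.sum_univ_castSucc G
  rw [Fin.sum_univ_succ] at h1
  show G 0 = G (Fin.last _)
  linear_combination h1 + hsum - two (∑ i : Fin u.length, G i.succ)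

lemma Emb.head_eq (h : Emb g k u w) (hu : u.IsValid)
    (hleg : Quot.mk w.RegionRel (h.side (Fin.last _, true)) =
      Quot.mk w.RegionRel (h.side (Fin.last _, false))) :
    Quot.mk w.RegionRel (h.side (0, true)) = Quot.mk w.RegionRel (h.side (0, false)) := by
  classical
  have := sum_ends hu (fun x => if Quot.mk w.RegionRel (h.side x) =
    Quot.mk w.RegionRel (h.side (0, true)) then 1 else 0) (fun a b hab => by
      simp only [Quot.sound (RegionRel.corner _ _ (h.corner hab))])
  simp only [hleg, CharTwo.add_self_eq_zero, if_true] at this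
  by_contra hne
  rw [if_neg (fun h' => hne h'.symm)] at this
  simp at this

lemma Emb.leg_eq (h : Emb g k u w) (hu : u.IsValid)
    (hhead : Quot.mk w.RegionRel (h.side (0, true)) =
      Quot.mk w.RegionRel (h.side (0, false))) :
    Quot.mk w.RegionRel (h.side (Fin.last _, true)) =
      Quot.mk w.RegionRel (h.side (Fin.last _, false)) := by
  classical
  have := sum_ends hu (fun x => if Quot.mk w.RegionRel (h.side x) =
    Quot.mk w.RegionRel (h.side (Fin.last _, true)) then 1 else 0) (fun a b hab => by
      simp only [Quot.sound (RegionRel.corner _ _ (h.corner hab))])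
  simp only [hhead, CharTwo.add_self_eq_zero, if_true] at this
  by_contra hne
  rw [if_neg (fun h' => hne h'.symm)] at this
  simp at this

/-- The map of regions induced by an embedding that respects the ends. -/
def Emb.map (h : Emb g k u w)
    (hhead : Quot.mk w.RegionRel (h.side (0, true)) =
      Quot.mk w.RegionRel (h.side (0, false)))
    (hleg : Quot.mk w.RegionRel (h.side (Fin.last _, true)) =
      Quot.mk w.RegionRel (h.side (Fin.last _, false))) : u.Region → w.Region :=
  Quot.lift (fun x => Quot.mk _ (h.side x)) (by
    intro a b hab
    cases hab with
    | corner a b hc => exact Quot.sound (.corner _ _ (h.corner hc))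
    | head => exact hhead
    | leg => exact hleg)

lemma Emb.bounds (h : Emb g 0 u w) (hl : w.length = u.length) :
    Quot.mk w.RegionRel (h.side (0, true)) = Quot.mk w.RegionRel (h.side (0, false)) ∧
    Quot.mk w.RegionRel (h.side (Fin.last _, true)) =
      Quot.mk w.RegionRel (h.side (Fin.last _, false)) := by
  have e0 : ∀ s, h.side (0, s) = (0, s) := fun s => Prod.ext (Fin.ext (by simp [side])) rfl
  have e1 : ∀ s, h.side (Fin.last _, s) = (Fin.last _, s) := fun s =>
    Prod.ext (Fin.ext (by simp [side, hl])) rfl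
  rw [e0, e0, e1, e1]
  exact ⟨Quot.sound .head, Quot.sound .leg⟩

lemma Emb.crosses_cases (h : Emb g 0 u w) (hl : w.length = u.length) {a b : w.Side}
    (hab : w.RegionRel a b) : ∃ a' b', u.RegionRel a' b' ∧ a = h.side a' ∧ b = h.side b' := by
  have hix : ∀ i : Fin w.length, ∃ i' : Fin u.length, i = h.ix i' := fun i =>
    ⟨⟨i, by omega⟩, Fin.ext (by simp [ix])⟩
  have e : ∀ i s, h.side (i.castSucc, s) = ((h.ix i).castSucc, s) := fun _ _ => rfl
  have e' : ∀ i s, h.side (i.succ, s) = ((h.ix i).succ, s) := fun _ _ => rfl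
  cases hab with
  | corner a b hc =>
    cases hc with
    | north i j hc =>
      obtain ⟨i, rfl⟩ := hix i
      obtain ⟨j, rfl⟩ := hix j
      exact ⟨_, _, .corner _ _ (.north i j ((h.crosses i j).1 hc)), rfl, rfl⟩
    | west i j hc =>
      obtain ⟨i, rfl⟩ := hix i
      obtain ⟨j, rfl⟩ := hix j
      exact ⟨_, _, .corner _ _ (.west i j ((h.crosses i j).1 hc)), rfl, rfl⟩
    | south i j hc =>
      obtain ⟨i, rfl⟩ := hix i
      obtain ⟨j, rfl⟩ := hix j
      exact ⟨_, _, .corner _ _ (.south i j ((h.crosses i j).1 hc)), rfl, rfl⟩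
    | east i j hc =>
      obtain ⟨i, rfl⟩ := hix i
      obtain ⟨j, rfl⟩ := hix j
      exact ⟨_, _, .corner _ _ (.east i j ((h.crosses i j).1 hc)), rfl, rfl⟩
  | head => exact ⟨_, _, .head, Prod.ext (Fin.ext (by simp [side])) rfl,
      Prod.ext (Fin.ext (by simp [side])) rfl⟩
  | leg => exact ⟨_, _, .leg, Prod.ext (Fin.ext (by simp [side, hl])) rfl,
      Prod.ext (Fin.ext (by simp [side, hl])) rfl⟩

lemma Emb.side_injective (h : Emb g k u w) : Function.Injective h.side := by
  intro x y hxy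
  have h1 := congrArg (fun z => (z.1 : ℕ)) hxy
  have h2 : x.2 = y.2 := congrArg (fun z : w.Side => z.2) hxy
  simp only [side] at h1
  exact Prod.ext (Fin.ext (by omega)) h2

lemma Emb.card_eq (h : Emb g 0 u w) (hl : w.length = u.length) :
    Nat.card w.Region = Nat.card u.Region := by
  symm
  apply Nat.card_congr
  have hs : ∀ x : w.Side, ∃ y : u.Side, h.side y = x := fun x =>
    ⟨(⟨x.1, by omega⟩, x.2), Prod.ext (Fin.ext (by simp [side])) rfl⟩
  choose t ht using hs
  have ht' : ∀ y, t (h.side y) = y := fun y => h.side_injective (ht _)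
  refine ⟨h.map (h.bounds hl).1 (h.bounds hl).2, Quot.lift (fun x => Quot.mk _ (t x)) ?_, ?_, ?_⟩
  · intro a b hab
    obtain ⟨a, b, hr, rfl, rfl⟩ := h.crosses_cases hl hab
    simp only [ht']
    exact Quot.sound hr
  · rintro ⟨x⟩
    exact congrArg (Quot.mk _) (ht' x)
  · rintro ⟨x⟩
    exact congrArg (Quot.mk _) (ht x)

lemma emb_mirror (w : GaussCode) : Emb Pass.mirror 0 w w.mirror where
  le := by simp [mirror]
  get i := by simp [mirror]
  label p q := Iff.rfl
  pos p := by simp [Pass.mirror]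

lemma emb_left (u v : GaussCode) : Emb (Pass.relabel fun k => 2 * k) 0 u (u.mul v) where
  le := by simp [mul]
  get i := by simp [mul]
  label p q := by simp [Pass.relabel]
  pos p := Iff.rfl

lemma emb_right (u v : GaussCode) :
    Emb (Pass.relabel fun k => 2 * k + 1) u.length v (u.mul v) where
  le := by simp [mul]
  get i := by simp [mul]
  label p q := by simp [Pass.relabel]
  pos p := Iff.rfl

lemma mem_mirror {w : GaussCode} {p : Pass} : p ∈ w.mirror ↔ p.mirror ∈ w := by
  have inv : ∀ p : Pass, p.mirror.mirror = p := fun p => by simp [Pass.mirror]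
  constructor
  · intro h
    obtain ⟨q, hq, rfl⟩ := List.mem_map.1 h
    rwa [inv]
  · intro h
    exact List.mem_map.2 ⟨_, h, inv p⟩

lemma IsValid.mirror (hw : w.IsValid) : w.mirror.IsValid := by
  refine ⟨hw.1.map fun p q h => ?_, fun p hp => ?_, fun p hp q hq h => ?_⟩
  · simp only [Pass.mirror, Pass.mk.injEq] at h
    exact Pass.ext h.1 (Bool.not_inj h.2.1) (Bool.not_inj h.2.2)
  · rw [mem_mirror] at hp ⊢
    exact hw.2.1 _ hp
  · rw [mem_mirror] at hp hq
    simpa [Pass.mirror] using hw.2.2 _ hp _ hq h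

lemma IsSpherical.mirror (hw : w.IsSpherical) : w.mirror.IsSpherical := by
  have hl : w.mirror.length = w.length := by simp [GaussCode.mirror]
  unfold IsSpherical
  rw [(emb_mirror w).card_eq hl, hl]
  exact hw

lemma IsValid.relabel (hw : w.IsValid) {f : ℕ → ℕ} (hf : Function.Injective f) :
    IsValid (w.map (Pass.relabel f)) := by
  refine ⟨hw.1.map fun p q h => ?_, fun p hp => ?_, fun p hp q hq h => ?_⟩
  · simp only [Pass.relabel, Pass.mk.injEq] at h
    exact Pass.ext (hf h.1) h.2.1 h.2.2
  · obtain ⟨p, hp', rfl⟩ := List.mem_map.1 hp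
    exact List.mem_map.2 ⟨_, hw.2.1 _ hp', rfl⟩
  · obtain ⟨p, hp', rfl⟩ := List.mem_map.1 hp
    obtain ⟨q, hq', rfl⟩ := List.mem_map.1 hq
    have h' : f p.label = f q.label := h
    exact hw.2.2 p hp' q hq' (hf h')

lemma IsValid.mul (hu : u.IsValid) (hv : v.IsValid) : (u.mul v).IsValid := by
  have h1 := hu.relabel (f := fun k => 2 * k) (fun a b h => by simpa using h)
  have h2 := hv.relabel (f := fun k => 2 * k + 1) (fun a b h => by simpa using h)
  have hd : ∀ p ∈ u.map (Pass.relabel fun k => 2 * k),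
      ∀ q ∈ v.map (Pass.relabel fun k => 2 * k + 1), p.label ≠ q.label := by
    intro p hp q hq
    obtain ⟨p, hp, rfl⟩ := List.mem_map.1 hp
    obtain ⟨q, hq, rfl⟩ := List.mem_map.1 hq
    simp only [Pass.relabel]
    omega
  refine ⟨List.nodup_append.2 ⟨h1.1, h2.1, fun p hp q hq h => hd p hp q hq (by rw [h])⟩,
    fun p hp => ?_, fun p hp q hq h => ?_⟩
  · rcases List.mem_append.1 hp with hp | hp
    · exact List.mem_append_left _ (h1.2.1 p hp)
    · exact List.mem_append_right _ (h2.2.1 p hp)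
  · rcases List.mem_append.1 hp with hp | hp <;> rcases List.mem_append.1 hq with hq | hq
    · exact h1.2.2 p hp q hq h
    · exact absurd h (hd p hp q hq)
    · exact absurd h.symm (hd q hq p hp)
    · exact h2.2.2 p hp q hq h

lemma mul_length (u v : GaussCode) : (u.mul v).length = u.length + v.length := by simp [mul]

/-- In a product the two sides of the edge at which the factors are joined bound one region. -/
lemma mul_joint (hu : u.IsValid) :
    Quot.mk (u.mul v).RegionRel ((emb_left u v).side (Fin.last _, true)) =
      Quot.mk (u.mul v).RegionRel ((emb_left u v).side (Fin.last _, false)) := by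
  have e0 : ∀ s, (emb_left u v).side (0, s) = (0, s) := fun s =>
    Prod.ext (Fin.ext (by simp [Emb.side])) rfl
  refine (emb_left u v).leg_eq hu ?_
  rw [e0, e0]
  exact Quot.sound .head

lemma joint_eq (u v : GaussCode) (s : Bool) :
    (emb_right u v).side (0, s) = (emb_left u v).side (Fin.last _, s) :=
  Prod.ext (Fin.ext (by simp [Emb.side])) rfl

/-- The regions of the first factor, as regions of the product. -/
def mapLeft (hu : u.IsValid) : u.Region → (u.mul v).Region :=
  (emb_left u v).map (by
    have e0 : ∀ s, (emb_left u v).side (0, s) = (0, s) := fun s =>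
      Prod.ext (Fin.ext (by simp [Emb.side])) rfl
    rw [e0, e0]
    exact Quot.sound .head) (mul_joint hu)

/-- The regions of the second factor, as regions of the product. -/
def mapRight (hu : u.IsValid) : v.Region → (u.mul v).Region :=
  (emb_right u v).map (by rw [joint_eq, joint_eq]; exact mul_joint hu) (by
    have e1 : ∀ s, (emb_right u v).side (Fin.last _, s) = (Fin.last _, s) := fun s =>
      Prod.ext (Fin.ext (by simp [Emb.side, mul_length])) rfl
    rw [e1, e1]
    exact Quot.sound .leg)

lemma mul_crosses {i j : Fin (u.mul v).length} (h : (u.mul v).Crosses i j) :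
    (∃ i' j', u.Crosses i' j' ∧ i = (emb_left u v).ix i' ∧ j = (emb_left u v).ix j') ∨
    (∃ i' j', v.Crosses i' j' ∧ i = (emb_right u v).ix i' ∧ j = (emb_right u v).ix j') := by
  have hix : ∀ i : Fin (u.mul v).length,
      (∃ i', i = (emb_left u v).ix i') ∨ ∃ i', i = (emb_right u v).ix i' := by
    intro i
    have hi := i.2
    have hl := mul_length u v
    by_cases h : i.1 < u.length
    · exact .inl ⟨⟨i, h⟩, Fin.ext (by simp [Emb.ix])⟩
    · exact .inr ⟨⟨i - u.length, by omega⟩, Fin.ext (by simp only [Emb.ix]; omega)⟩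
  have gl : ∀ i, (u.mul v)[(emb_left u v).ix i] = _ := (emb_left u v).get
  have gr : ∀ i, (u.mul v)[(emb_right u v).ix i] = _ := (emb_right u v).get
  rcases hix i with ⟨i, rfl⟩ | ⟨i, rfl⟩ <;> rcases hix j with ⟨j, rfl⟩ | ⟨j, rfl⟩
  · exact .inl ⟨i, j, ((emb_left u v).crosses i j).1 h, rfl, rfl⟩
  · have := h.1
    rw [gl, gr] at this
    simp only [Pass.relabel] at this
    omega
  · have := h.1
    rw [gl, gr] at this
    simp only [Pass.relabel] at this
    omega
  · exact .inr ⟨i, j, ((emb_right u v).crosses i j).1 h, rfl, rfl⟩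

lemma mul_corner {a b : (u.mul v).Side} (h : (u.mul v).Corner a b) :
    (∃ a' b', u.Corner a' b' ∧ a = (emb_left u v).side a' ∧ b = (emb_left u v).side b') ∨
    (∃ a' b', v.Corner a' b' ∧ a = (emb_right u v).side a' ∧ b = (emb_right u v).side b') := by
  cases h with
  | north i j hc =>
    rcases mul_crosses hc with ⟨i, j, h', rfl, rfl⟩ | ⟨i, j, h', rfl, rfl⟩
    · exact .inl ⟨_, _, .north i j h', rfl, rfl⟩
    · exact .inr ⟨_, _, .north i j h', rfl, rfl⟩
  | west i j hc =>
    rcases mul_crosses hc with ⟨i, j, h', rfl, rfl⟩ | ⟨i, j, h', rfl, rfl⟩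
    · exact .inl ⟨_, _, .west i j h', rfl, rfl⟩
    · exact .inr ⟨_, _, .west i j h', rfl, rfl⟩
  | south i j hc =>
    rcases mul_crosses hc with ⟨i, j, h', rfl, rfl⟩ | ⟨i, j, h', rfl, rfl⟩
    · exact .inl ⟨_, _, .south i j h', rfl, rfl⟩
    · exact .inr ⟨_, _, .south i j h', rfl, rfl⟩
  | east i j hc =>
    rcases mul_crosses hc with ⟨i, j, h', rfl, rfl⟩ | ⟨i, j, h', rfl, rfl⟩
    · exact .inl ⟨_, _, .east i j h', rfl, rfl⟩
    · exact .inr ⟨_, _, .east i j h', rfl, rfl⟩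

instance (w : GaussCode) : Finite w.Region := inferInstanceAs (Finite (Quot _))

open Classical in
/-- The regions of a product are those of the first factor and those of the second, except that
the region of the leg of the first factor is merged with that of the head of the second. -/
lemma mul_card (hu : u.IsValid) :
    Nat.card (u.mul v).Region + 1 = Nat.card u.Region + Nat.card v.Region := by
  set H : v.Region := v.region 0 true with hH
  have hH' : v.region 0 false = H := (Quot.sound .head).symm
  set ρ : v.Region → u.Region ⊕ {r : v.Region // r ≠ H} := fun r =>
    if h : r = H then .inl (u.region (Fin.last _) true) else .inr ⟨r, h⟩ with hρ
  have hρH : ρ H = .inl (u.region (Fin.last _) true) := by simp [hρ]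
  set F : (u.mul v).Side → u.Region ⊕ {r : v.Region // r ≠ H} := fun x =>
    if h : x.1.1 ≤ u.length then .inl (u.region ⟨x.1, by omega⟩ x.2)
    else ρ (v.region ⟨x.1 - u.length, by
      have := x.1.2
      have := mul_length u v
      omega⟩ x.2) with hF
  have legu : ∀ s, u.region (Fin.last _) s = u.region (Fin.last _) true := by
    intro s
    cases s
    · exact (Quot.sound .leg).symm
    · rfl
  have headv : ∀ s, v.region 0 s = H := by
    intro s
    cases s
    · exact hH'
    · rfl
  have FL : ∀ x : u.Side, F ((emb_left u v).side x) = .inl (Quot.mk _ x) := by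
    intro x
    have : ((emb_left u v).side x).1.1 = x.1.1 := by simp [Emb.side]
    simp only [hF]
    rw [dif_pos (by have := x.1.2; omega)]
    congr 1
    exact congrArg (Quot.mk _) (Prod.ext (Fin.ext this) rfl)
  have FR : ∀ x : v.Side, F ((emb_right u v).side x) = ρ (Quot.mk _ x) := by
    intro x
    have h1 : ((emb_right u v).side x).1.1 = u.length + x.1.1 := by simp [Emb.side]
    by_cases hx : x.1 = 0
    · obtain ⟨e, s⟩ := x
      simp only at hx
      subst hx
      rw [joint_eq, FL]
      have h2 : ρ (Quot.mk _ (0, s)) = ρ H := congrArg ρ (headv s)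
      rw [h2, hρH]
      exact congrArg Sum.inl (legu s)
    · have hx' : x.1.1 ≠ 0 := fun h => hx (Fin.ext h)
      simp only [hF]
      rw [dif_neg (by omega)]
      congr 1
      exact congrArg (Quot.mk _) (Prod.ext (Fin.ext (by simp only; omega)) rfl)
  have Fr : ∀ a b, (u.mul v).RegionRel a b → F a = F b := by
    intro a b hab
    cases hab with
    | corner a b hc =>
      rcases mul_corner hc with ⟨a, b, h', rfl, rfl⟩ | ⟨a, b, h', rfl, rfl⟩
      · rw [FL, FL, Quot.sound (.corner _ _ h')]
      · rw [FR, FR, Quot.sound (.corner _ _ h')]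
    | head =>
      have e0 : ∀ s, (0, s) = (emb_left u v).side (0, s) := fun s =>
        Prod.ext (Fin.ext (by simp [Emb.side])) rfl
      rw [e0, e0, FL, FL, Quot.sound .head]
    | leg =>
      have e1 : ∀ s, (Fin.last _, s) = (emb_right u v).side (Fin.last _, s) := fun s =>
        Prod.ext (Fin.ext (by simp [Emb.side, mul_length])) rfl
      rw [e1, e1, FR, FR, Quot.sound .leg]
  have mH : mapRight (v := v) hu H = mapLeft (v := v) hu (u.region (Fin.last _) true) :=
    congrArg (Quot.mk _) (joint_eq u v true)
  have mρ : ∀ r, Sum.elim (mapLeft (v := v) hu) (fun r => mapRight hu r.1) (ρ r) =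
      mapRight hu r := by
    intro r
    by_cases h : r = H
    · rw [h, hρH, mH]
      rfl
    · simp [hρ, h]
  have hside : ∀ x : (u.mul v).Side,
      (∃ y, x = (emb_left u v).side y) ∨ ∃ y, x = (emb_right u v).side y := by
    intro x
    have hx := x.1.2
    have hl := mul_length u v
    by_cases h : x.1.1 ≤ u.length
    · exact .inl ⟨(⟨x.1, by omega⟩, x.2), Prod.ext (Fin.ext (by simp [Emb.side])) rfl⟩
    · exact .inr ⟨(⟨x.1 - u.length, by omega⟩, x.2),
        Prod.ext (Fin.ext (by simp only [Emb.side]; omega)) rfl⟩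
  let E : (u.mul v).Region ≃ u.Region ⊕ {r : v.Region // r ≠ H} :=
    { toFun := Quot.lift F Fr
      invFun := Sum.elim (mapLeft hu) (fun r => mapRight hu r.1)
      left_inv := by
        rintro ⟨x⟩
        rcases hside x with ⟨y, rfl⟩ | ⟨y, rfl⟩
        · show Sum.elim _ _ (F _) = _
          rw [FL]
          rfl
        · show Sum.elim _ _ (F _) = _
          rw [FR]
          exact mρ (Quot.mk _ y)
      right_inv := by
        rintro (⟨⟨x⟩⟩ | ⟨⟨x⟩, hx⟩)
        · exact FL x
        · refine (FR x).trans ?_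
          simp only [hρ]
          rw [dif_neg hx] }
  rw [Nat.card_congr E, Nat.card_sum, add_assoc]
  congr 1
  have := Nat.card_congr (Equiv.sumCompl (fun r : v.Region => r = H))
  rw [Nat.card_sum, Nat.card_unique] at this
  rw [← this, add_comm]

lemma IsSpherical.mul (hu : u.IsValid) (h₁ : u.IsSpherical) (h₂ : v.IsSpherical) :
    (u.mul v).IsSpherical := by
  have := mul_card (v := v) hu
  have := mul_length u v
  unfold IsSpherical at *
  omega

/-! #### Facts needed to see that mirrors and products of knotoids are well defined -/

lemma Move.r2' {w w' : GaussCode} {A B C : GaussCode} {k l : ℕ} {o s d : Bool} (e f : w.Edge)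
    (hw : w = A ++ B ++ C)
    (hw' : w' = A ++ [⟨k, o, s⟩, ⟨l, o, !s⟩] ++ B ++ seg d ⟨k, !o, s⟩ ⟨l, !o, !s⟩ ++ C)
    (he : (e : ℕ) = A.length) (hf : (f : ℕ) = A.length + B.length)
    (h : w.region e (d != (o == s)) = w.region f (o == s)) : Move w w' := by
  subst hw hw'
  exact .r2 A B C k l o s d e f he hf h

lemma map_seg (g : Pass → Pass) (p : Bool) (a b : Pass) :
    (seg p a b).map g = seg p (g a) (g b) := by
  cases p <;> rfl

lemma Move.mirror {u u' : GaussCode} (h : Move u u') : Move u.mirror u'.mirror := by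
  cases h with
  | relabel _ f =>
    have : (u.map (Pass.relabel f)).map Pass.mirror =
        (u.map Pass.mirror).map (Pass.relabel f) := by
      simp [List.map_map, Function.comp_def, Pass.mirror, Pass.relabel]
    unfold GaussCode.mirror
    rw [this]
    exact .relabel _ f
  | r1 A B k o s =>
    simp only [GaussCode.mirror, List.map_append]
    exact .r1 _ _ k (!o) (!s)
  | r2 A B C k l o s d e f he hf h =>
    have E := emb_mirror (A ++ B ++ C)
    have b := E.bounds (by simp [GaussCode.mirror])
    have h' := congrArg (E.map b.1 b.2) h
    have hos : ((!o) == (!s)) = (o == s) := by cases o <;> cases s <;> rfl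
    refine Move.r2' (A := A.map Pass.mirror) (B := B.map Pass.mirror) (C := C.map Pass.mirror)
      (k := k) (l := l) (o := !o) (s := !s) (d := d)
      (E.side (e, true)).1 (E.side (f, true)).1 ?_ ?_ ?_ ?_ ?_
    · simp [GaussCode.mirror]
    · simp [GaussCode.mirror, map_seg, Pass.mirror]
    · simp [Emb.side, he]
    · simp [Emb.side, hf]
    · rw [hos]
      exact h'
  | r3 A B C E S₁ S₂ S₃ x y z a b c p q r h₁ h₂ hS =>
    simp only [GaussCode.mirror, List.map_append, List.map_reverse]
    refine .r3 _ _ _ _ _ _ _ z y x (!c) (!b) (!a) (!r) (!q) (!p) ?_ ?_ ?_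
    · revert h₁ h₂
      cases p <;> cases q <;> cases r <;> cases a <;> cases b <;> cases c <;> decide
    · revert h₁ h₂
      cases p <;> cases q <;> cases r <;> cases a <;> cases b <;> cases c <;> decide
    · have h := hS.map (List.map Pass.mirror)
      simp only [List.map_cons, List.map_nil, map_seg, Pass.mirror] at h
      have sw : ∀ (p : Bool) (a b : Pass), seg (!p) b a = seg p a b := by
        intro p a b
        cases p <;> rfl
      rw [sw, sw, sw]
      refine h.trans ?_
      refine (List.reverse_perm _).symm.trans ?_
      simp

lemma Move.mul_right {u u' : GaussCode} (hu : u.IsValid) (h : Move u u') :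
    Move (u.mul v) (u'.mul v) := by
  cases h with
  | relabel _ f =>
    have : mul (u.map (Pass.relabel f)) v = (u.mul v).map (Pass.relabel
        ((Equiv.natSumNatEquivNat.symm.trans (f.sumCongr (Equiv.refl ℕ))).trans
          Equiv.natSumNatEquivNat)) := by
      simp [mul, Pass.relabel, Function.comp_def]
    rw [this]
    exact .relabel _ _
  | r1 A B k o s =>
    have := Move.r1 (A.map (Pass.relabel fun k => 2 * k))
      (B.map (Pass.relabel fun k => 2 * k) ++ v.map (Pass.relabel fun k => 2 * k + 1)) (2 * k) o s
    simpa [mul, Pass.relabel] using this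
  | r2 A B C k l o s d e f he hf h =>
    have h' := congrArg (mapLeft (v := v) hu) h
    refine Move.r2' (A := A.map (Pass.relabel fun k => 2 * k))
      (B := B.map (Pass.relabel fun k => 2 * k))
      (C := C.map (Pass.relabel fun k => 2 * k) ++ v.map (Pass.relabel fun k => 2 * k + 1))
      (k := 2 * k) (l := 2 * l) (o := o) (s := s) (d := d)
      ((emb_left (A ++ B ++ C) v).side (e, true)).1 ((emb_left (A ++ B ++ C) v).side (f, true)).1
      ?_ ?_ ?_ ?_ h'
    · simp [mul]
    · simp [mul, map_seg, Pass.relabel]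
    · simp [Emb.side, he]
    · simp [Emb.side, hf]
  | r3 A B C E S₁ S₂ S₃ x y z a b c p q r h₁ h₂ hS =>
    have h := hS.map (List.map (Pass.relabel fun k => 2 * k))
    simp only [List.map_cons, List.map_nil, map_seg] at h
    have := Move.r3 (A.map (Pass.relabel fun k => 2 * k)) (B.map (Pass.relabel fun k => 2 * k))
      (C.map (Pass.relabel fun k => 2 * k))
      (E.map (Pass.relabel fun k => 2 * k) ++ v.map (Pass.relabel fun k => 2 * k + 1))
      _ _ _ (2 * x) (2 * y) (2 * z) a b c p q r h₁ h₂ h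
    simpa [mul] using this

lemma Move.mul_left (hu : u.IsValid) {v v' : GaussCode} (h : Move v v') :
    Move (u.mul v) (u.mul v') := by
  cases h with
  | relabel _ f =>
    have : u.mul (v.map (Pass.relabel f)) = (u.mul v).map (Pass.relabel
        ((Equiv.natSumNatEquivNat.symm.trans ((Equiv.refl ℕ).sumCongr f)).trans
          Equiv.natSumNatEquivNat)) := by
      simp [mul, Pass.relabel, Function.comp_def]
    rw [this]
    exact .relabel _ _
  | r1 A B k o s =>
    have := Move.r1 (u.map (Pass.relabel fun k => 2 * k) ++
      A.map (Pass.relabel fun k => 2 * k + 1))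
      (B.map (Pass.relabel fun k => 2 * k + 1)) (2 * k + 1) o s
    simpa [mul, Pass.relabel] using this
  | r2 A B C k l o s d e f he hf h =>
    have h' := congrArg (mapRight (u := u) hu) h
    refine Move.r2' (A := u.map (Pass.relabel fun k => 2 * k) ++
        A.map (Pass.relabel fun k => 2 * k + 1))
      (B := B.map (Pass.relabel fun k => 2 * k + 1))
      (C := C.map (Pass.relabel fun k => 2 * k + 1))
      (k := 2 * k + 1) (l := 2 * l + 1) (o := o) (s := s) (d := d)
      ((emb_right u (A ++ B ++ C)).side (e, true)).1
      ((emb_right u (A ++ B ++ C)).side (f, true)).1 ?_ ?_ ?_ ?_ h'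
    · simp [mul]
    · simp [mul, map_seg, Pass.relabel]
    · simp [Emb.side, he]
    · simp [Emb.side, hf, add_assoc]
  | r3 A B C E S₁ S₂ S₃ x y z a b c p q r h₁ h₂ hS =>
    have h := hS.map (List.map (Pass.relabel fun k => 2 * k + 1))
    simp only [List.map_cons, List.map_nil, map_seg] at h
    have := Move.r3 (u.map (Pass.relabel fun k => 2 * k) ++
        A.map (Pass.relabel fun k => 2 * k + 1)) (B.map (Pass.relabel fun k => 2 * k + 1))
      (C.map (Pass.relabel fun k => 2 * k + 1)) (E.map (Pass.relabel fun k => 2 * k + 1))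
      _ _ _ (2 * x + 1) (2 * y + 1) (2 * z + 1) a b c p q r h₁ h₂ h
    simpa [mul] using this

end GaussCode

/-! ### Knotoids in the sphere -/

/-- An (oriented) knotoid diagram in the oriented sphere, up to isotopy of the sphere. -/
structure KnotoidDiagram where
  code : GaussCode
  valid : code.IsValid
  spherical : code.IsSpherical

namespace KnotoidDiagram

/-- The trivial diagram: an embedded interval. -/
def trivial : KnotoidDiagram where
  code := []
  valid := ⟨List.nodup_nil, by simp, by simp⟩
  spherical := by
    have : Nat.card (GaussCode.Region []) = 1 := by
      rw [Nat.card_eq_one_iff_unique]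
      refine ⟨⟨?_⟩, ⟨Quot.mk _ (0, true)⟩⟩
      have : ∀ r : GaussCode.Region [], r = GaussCode.region [] 0 true := by
        rintro ⟨e, s⟩
        have he : e = 0 := Fin.ext (by have := e.2; simp at this; simp)
        subst he
        cases s
        · exact (Quot.sound .head).symm
        · rfl
      intro a b
      rw [this a, this b]
    simp [GaussCode.IsSpherical, this]

/-- The mirror image: all crossings are switched. -/
def mirror (D : KnotoidDiagram) : KnotoidDiagram where
  code := D.code.mirror
  valid := D.valid.mirror
  spherical := D.spherical.mirror

/-- The product diagram `D D'`: the sphere minus a disc around the leg of `D` is glued to the sphere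
minus a disc around the head of `D'`, so that one first travels along `D` and then along `D'`. -/
def mul (D D' : KnotoidDiagram) : KnotoidDiagram where
  code := D.code.mul D'.code
  valid := D.valid.mul D'.valid
  spherical := .mul D.valid D.spherical D'.spherical

/-- Equivalence of diagrams, generated by isotopy and Reidemeister moves in the sphere. -/
def setoid : Setoid KnotoidDiagram :=
  Relation.EqvGen.setoid fun D D' => GaussCode.Move D.code D'.code

end KnotoidDiagram

/-- Knotoids in the sphere. -/
def Knotoid := Quotient KnotoidDiagram.setoid

namespace Knotoid

/-- The knotoid represented by a diagram. -/
def mk (D : KnotoidDiagram) : Knotoid := Quotient.mk _ D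

/-- The mirror image of a knotoid. -/
def mirror : Knotoid → Knotoid :=
  Quotient.map' KnotoidDiagram.mirror (by
    intro D D' h
    induction h with
    | rel _ _ h => exact .rel _ _ h.mirror
    | refl => exact .refl _
    | symm _ _ _ ih => exact .symm _ _ ih
    | trans _ _ _ _ _ ih₁ ih₂ => exact .trans _ _ _ ih₁ ih₂)

/-- The product of knotoids. -/
def mul : Knotoid → Knotoid → Knotoid :=
  Quotient.map₂ KnotoidDiagram.mul (by
    intro D D' h E E' h'
    have h₁ : KnotoidDiagram.setoid (D.mul E) (D'.mul E) := by
      induction h with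
      | rel D _ h => exact .rel _ _ (h.mul_right D.valid)
      | refl => exact .refl _
      | symm _ _ _ ih => exact .symm _ _ ih
      | trans _ _ _ _ _ ih₁ ih₂ => exact .trans _ _ _ ih₁ ih₂
    have h₂ : KnotoidDiagram.setoid (D'.mul E) (D'.mul E') := by
      clear h₁
      induction h' with
      | rel _ _ h => exact .rel _ _ (h.mul_left D'.valid)
      | refl => exact .refl _
      | symm _ _ _ ih => exact .symm _ _ ih
      | trans _ _ _ _ _ ih₁ ih₂ => exact .trans _ _ _ ih₁ ih₂
    exact .trans _ _ _ h₁ h₂)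

/-- The product of `n` factors `κ`; the empty product is the trivial knotoid. -/
def pow (κ : Knotoid) : ℕ → Knotoid
  | 0 => mk .trivial
  | n + 1 => (κ.pow n).mul κ

end Knotoid

/-! ### The knotoid `2₁` -/

/-- Starting at the head one passes crossing `0` under, crossing `1` over, crossing `0` over and
crossing `1` under. Both crossings have the same sign, and the choice of this sign gives two
diagrams, which are reflections of each other in a line of the plane. -/
def GaussCode.bifoil (s : Bool) : GaussCode :=
  [⟨0, false, s⟩, ⟨1, true, s⟩, ⟨0, true, s⟩, ⟨1, false, s⟩]

lemma GaussCode.bifoil_valid (s : Bool) : (bifoil s).IsValid := by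
  refine ⟨?_, ?_, ?_⟩ <;> simp [bifoil, Pass.swap]

lemma GaussCode.bifoil_card (s : Bool) : Nat.card (bifoil s).Region = 3 := by
  have c : ∀ i j : Fin 4, (bifoil s).Crosses i j ↔
      (s = true ∧ ((i = 2 ∧ j = 0) ∨ (i = 1 ∧ j = 3))) ∨
      (s = false ∧ ((i = 0 ∧ j = 2) ∨ (i = 3 ∧ j = 1))) := by
    intro i j
    fin_cases i <;> fin_cases j <;> cases s <;> simp [Crosses, bifoil]
  let F : Fin 5 × Bool → Fin 3 := fun x =>
    (![![0, 0], ![1, 2], ![0, 2], ![0, 1], ![2, 2]] : Fin 5 → Fin 2 → Fin 3) x.1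
      (if x.2 = s then 1 else 0)
  have hF : ∀ a b, (bifoil s).RegionRel a b → F a = F b := by
    intro a b h
    cases h with
    | corner a b h =>
      cases h with
      | north i j h =>
        rcases (c i j).1 h with ⟨rfl, ⟨rfl, rfl⟩ | ⟨rfl, rfl⟩⟩ | ⟨rfl, ⟨rfl, rfl⟩ | ⟨rfl, rfl⟩⟩ <;> rfl
      | west i j h =>
        rcases (c i j).1 h with ⟨rfl, ⟨rfl, rfl⟩ | ⟨rfl, rfl⟩⟩ | ⟨rfl, ⟨rfl, rfl⟩ | ⟨rfl, rfl⟩⟩ <;> rfl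
      | south i j h =>
        rcases (c i j).1 h with ⟨rfl, ⟨rfl, rfl⟩ | ⟨rfl, rfl⟩⟩ | ⟨rfl, ⟨rfl, rfl⟩ | ⟨rfl, rfl⟩⟩ <;> rfl
      | east i j h =>
        rcases (c i j).1 h with ⟨rfl, ⟨rfl, rfl⟩ | ⟨rfl, rfl⟩⟩ | ⟨rfl, ⟨rfl, rfl⟩ | ⟨rfl, rfl⟩⟩ <;> rfl
    | head => cases s <;> rfl
    | leg => cases s <;> rfl
  let r : Fin 5 → Bool → (bifoil s).Region := fun e b => Quot.mk _ (e, b)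
  have hc : ∀ i j : Fin 4, (bifoil s).Crosses i j →
      r i.succ true = r j.succ false ∧ r j.succ true = r i.castSucc true ∧
      r i.castSucc false = r j.castSucc true ∧ r j.castSucc false = r i.succ false := fun i j h =>
    ⟨Quot.sound (.corner _ _ (Corner.north (w := bifoil s) i j h)),
      Quot.sound (.corner _ _ (Corner.west (w := bifoil s) i j h)),
      Quot.sound (.corner _ _ (Corner.south (w := bifoil s) i j h)),
      Quot.sound (.corner _ _ (Corner.east (w := bifoil s) i j h))⟩
  have h0 : r 0 true = r 0 false := Quot.sound .head
  have h4 : r 4 true = r 4 false := Quot.sound .leg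
  let R : Fin 3 → (bifoil s).Region := fun n => r (![0, 3, 4] n) s
  have hR : ∀ e b, R (F (e, b)) = r e b := by
    cases s with
    | true =>
      have c0 : r 3 true = r 1 false ∧ r 1 true = r 2 true ∧ r 2 false = r 0 true ∧
        r 0 false = r 3 false := hc 2 0 ((c 2 0).2 (by decide))
      have c1 : r 2 true = r 4 false ∧ r 4 true = r 1 true ∧ r 1 false = r 3 true ∧
        r 3 false = r 2 false := hc 1 3 ((c 1 3).2 (by decide))
      intro e b
      fin_cases e <;> cases b <;> simp [R, F] <;> grind
    | false =>
      have c0 : r 1 true = r 3 false ∧ r 3 true = r 0 true ∧ r 0 false = r 2 true ∧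
        r 2 false = r 1 false := hc 0 2 ((c 0 2).2 (by decide))
      have c1 : r 4 true = r 2 false ∧ r 2 true = r 3 true ∧ r 3 false = r 1 true ∧
        r 1 false = r 4 false := hc 3 1 ((c 3 1).2 (by decide))
      intro e b
      fin_cases e <;> cases b <;> simp [R, F] <;> grind
  let E : (bifoil s).Region ≃ Fin 3 :=
    { toFun := Quot.lift F hF
      invFun := R
      left_inv := by
        rintro ⟨e, b⟩
        exact hR e b
      right_inv := by
        intro n
        show F (![0, 3, 4] n, s) = n
        fin_cases n <;> simp [F] }
  rw [Nat.card_congr E, Nat.card_fin]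

namespace Knotoid

/-- The knotoid `2₁`, for either of the two reflections. -/
def bifoil (s : Bool) : Knotoid :=
  mk ⟨GaussCode.bifoil s, GaussCode.bifoil_valid s, by
    simp only [GaussCode.IsSpherical, GaussCode.bifoil_card]; rfl⟩

end Knotoid

/-! ### Shadow quandle colorings

Mathlib writes quandles with the operation `y ◃ x`; the exponential notation is `x ^ y = y ◃ x`.
In particular `x ^ y = 2 * y - x` in the dihedral quandle. -/

/-- `Y` is an `X`-set, for a quandle `X`. -/
class QuandleSet (X Y : Type*) [Quandle X] where
  /-- The action `y * x`. -/
  act : Y → X → Y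
  bijective : ∀ x, Function.Bijective fun y => act y x
  act_act : ∀ y a b, act (act y a) b = act (act y b) (Shelf.act b a)

/-- Every quandle acts on itself by `y * x = y ^ x`. -/
instance QuandleSet.self (X : Type*) [Quandle X] : QuandleSet X X where
  act y x := Shelf.act x y
  bijective x := (Rack.act' x).bijective
  act_act _ _ _ := Shelf.self_distrib

namespace KnotoidDiagram

/-- An `(X, Y)`-coloring of a diagram. The co-orientation normal of an oriented arc points to its
left. -/
@[ext] structure Coloring (X Y : Type*) [Quandle X] [QuandleSet X Y] (D : KnotoidDiagram) where
  /-- The colors of the arcs. -/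
  arc : D.code.Arc → X
  /-- The colors of the regions. -/
  region : D.code.Region → Y
  /-- Let `i` be the over-passage and `j` the under-passage of a crossing, and let `y` be the color of
  the over-arc. If the normal of the over-arc points from the under-arc colored `x` to the other
  under-arc, then the latter is colored `x ^ y`. (At a positive crossing the under-strand crosses
  from right to left.) -/
  crossing : ∀ i j : Fin D.code.length, D.code[i].label = D.code[j].label →
    D.code[i].isOver = true → D.code[j].isOver = false →
    if D.code[i].isPos then
      arc (D.code.arc j.succ) =
        Shelf.act (arc (D.code.arc i.castSucc)) (arc (D.code.arc j.castSucc))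
    else
      arc (D.code.arc j.castSucc) =
        Shelf.act (arc (D.code.arc i.castSucc)) (arc (D.code.arc j.succ))
  /-- If the normal of an arc colored `x` points from a region colored `y` to an adjacent region, then
  the latter is colored `y * x`. At the edge that ends at the head or at the leg, both
  sides belong to the same region, and its color has to satisfy `y * x = y`. -/
  side : ∀ e : D.code.Edge, region (D.code.region e true) =
    QuandleSet.act (region (D.code.region e false)) (arc (D.code.arc e))

/-- The shadow coloring number `col_(X,Y)`. -/
noncomputable def col (X Y : Type*) [Quandle X] [QuandleSet X Y] (D : KnotoidDiagram) : ℕ :=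
  Nat.card (D.Coloring X Y)

end KnotoidDiagram

/-! In `R₃` the elements `a`, `b`, `a ^ b` always sum to zero. The side condition therefore says
that the color of an arc is minus the sum of the colors of the two regions along any of its edges.
Arc colors can thus be eliminated: a shadow coloring is a coloring of the regions for which this sum
does not change along an over-passage. The crossing condition is then automatic, because the three
arc colors at a crossing add up to a multiple of three (`card_regionColoring`, `col_eq_walkCount`).

Region colorings of this kind make sense in any abelian group `G`, and their number `walkCount G` is
a knotoid invariant (`Move.walkCount_eq`). Under each Reidemeister move a coloring on one side
determines exactly one on the other: the sum condition along an over-strand forces the color of the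
new region inside a kink, a bigon or a flipped triangle. Colorings are stored as lists of colored
passages, so that a move rewrites a few short segments and the conditions at all other crossings are
untouched.

In a product the two sides of the joining edge lie in one region. A coloring of the product is
therefore a coloring of the first factor together with a coloring of the second whose head color is
the leg color of the first (`walkCount_mul`).

The diagram of `2₁` has three regions, with color `a` at the head, `b` at the leg, and a third color
`c`. Its two over-passages are consecutive, and constancy of the sum reads `b + c = b + a = c + a`,
so all colors equal `a`: each factor `2₁` multiplies the count by 1. In the mirror image the
over-passages are the first and the last, and the conditions are `a + a = b + c` and `a + c = b +
b`. Modulo 3 the second follows from the first, so `b` is free: each factor multiplies the count by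
3 (`strandRel_bifoil`). Starting from 3 colorings of the trivial knotoid, this gives `3` and `3 ^ (n
+ 1)`. The powers of `2₁` all have the same count and are told apart by their mirrors. -/

namespace GaussCode

/-! ### Colorings of the regions with values in an abelian group

In the dihedral quandle `R₃` the three elements `a`, `b`, `a ^ b` always add up to zero. Hence the
color of an arc is determined by the colors of the two regions next to it, and a shadow coloring is
the same as a coloring of the regions for which the sum of the colors of the two sides is constant
along every over-passage. This makes sense in any abelian group. -/

/-- The colors `(left, right)` of the two regions next to an edge. -/
abbrev SidePair (G : Type*) := G × G

/-- The color on the given side. -/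
def SidePair.get {G : Type*} (m : SidePair G) (s : Bool) : G := if s then m.1 else m.2

/-- The pair with color `x` on side `s` and color `y` on the other side. -/
def SidePair.mk {G : Type*} (s : Bool) (x y : G) : SidePair G := if s then (x, y) else (y, x)

/-! ### The equations at a crossing, and their solutions in the three Reidemeister configurations.
-/

section Crossing

variable {G : Type*} [AddCommGroup G]

/-- The corners of a crossing match; the strand from `j` to `j'` crosses the one from `i` to `i'`
from right to left. -/
def CornersMatch (i i' j j' : SidePair G) : Prop :=
  i'.1 = j'.2 ∧ j'.1 = i.1 ∧ i.2 = j.1 ∧ j.2 = i'.2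

/-- The condition at a crossing of sign `s`, whose over-strand leads from `o` to `o'` and whose
under-strand leads from `u` to `u'`. -/
def CrossingRel (s : Bool) (o o' u u' : SidePair G) : Prop :=
  o.1 + o.2 = o'.1 + o'.2 ∧ if s then CornersMatch o o' u u' else CornersMatch u u' o o'

/-- The corner inside the loop matches itself, so one corner equation is void. The other three, with
the sum condition along the over-strand, determine the color inside the loop and restore the
original colors after it. -/
lemma crossingRel_kink (s : Bool) (m n m' : SidePair G) :
    CrossingRel s m n n m' ↔ n = m.swap ∧ m' = m := by
  obtain ⟨m₁, m₂⟩ := m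
  obtain ⟨n₁, n₂⟩ := n
  obtain ⟨m₁', m₂'⟩ := m'
  cases s <;> simp [CrossingRel, CornersMatch] <;> grind

lemma crossingRel_kink' (s : Bool) (m n m' : SidePair G) :
    CrossingRel s n m' m n ↔ n = m.swap ∧ m' = m := by
  obtain ⟨m₁, m₂⟩ := m
  obtain ⟨n₁, n₂⟩ := n
  obtain ⟨m₁', m₂'⟩ := m'
  cases s <;> simp [CrossingRel, CornersMatch] <;> grind

/-- The condition at a crossing of two strands, of which the first one is the over-strand iff `o`. -/
def StrandRel (o s : Bool) (a a' b b' : SidePair G) : Prop :=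
  if o then CrossingRel s a a' b b' else CrossingRel s b b' a a'

/-- The color of the bigon created by pulling a strand with colors `m` over or under a strand with
colors `m'`; the sides facing each other are `t` and `t'`. -/
def bigonColor (o t t' : Bool) (m m' : SidePair G) : G :=
  if o then m.1 + m.2 - m'.get (!t') else m'.1 + m'.2 - m.get (!t)

/-- The middle edge of each strand sees the region beyond the other strand on the facing side and
the bigon on its other side. Constancy of the sum along the over-strand fixes the color of the
bigon. That the two strands face a common color is a consequence of the corner equations. -/
lemma strandRel_bigon (o s d : Bool) (m n l m' n' l' : SidePair G) :
    (StrandRel o s m n (if d then m' else n') (if d then n' else l') ∧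
      StrandRel o (!s) n l (if d then n' else m') (if d then l' else n')) ↔
    l = m ∧ l' = m' ∧ m.get (d != (o == s)) = m'.get (o == s) ∧
      n = SidePair.mk (d != (o == s)) (m'.get (!(o == s)))
        (bigonColor o (d != (o == s)) (o == s) m m') ∧
      n' = SidePair.mk (o == s) (m.get (!(d != (o == s))))
        (bigonColor o (d != (o == s)) (o == s) m m') := by
  obtain ⟨m₁, m₂⟩ := m
  obtain ⟨n₁, n₂⟩ := n
  obtain ⟨l₁, l₂⟩ := l
  obtain ⟨m₁', m₂'⟩ := m'
  obtain ⟨n₁', n₂'⟩ := n'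
  obtain ⟨l₁', l₂'⟩ := l'
  cases o <;> cases s <;> cases d <;>
    simp [StrandRel, CrossingRel, CornersMatch, SidePair.mk, SidePair.get, bigonColor] <;> grind

/-- The colors of the middle edge of a strand of a triangle after the third Reidemeister move; the
strand has colors `m`, `n`, `l`. -/
def triangleShift (p : Bool) (m n l : SidePair G) : SidePair G :=
  if p then n + m - l else n + l - m

lemma triangleShift_triangleShift (p : Bool) (m n l : SidePair G) :
    triangleShift (!p) m (triangleShift p m n l) l = n := by
  cases p <;> simp [triangleShift]

/-- The conditions at the three crossings of a triangle, with the notation of `Move.r3`: the colors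
of the top, middle and bottom strand are `t`, `m`, `u`. -/
def TriangleRel (a b c p q r : Bool) (t₀ t₁ t₂ m₀ m₁ m₂ u₀ u₁ u₂ : SidePair G) : Prop :=
  CrossingRel a (if p then t₀ else t₁) (if p then t₁ else t₂)
    (if q then m₀ else m₁) (if q then m₁ else m₂) ∧
  CrossingRel b (if p then t₁ else t₀) (if p then t₂ else t₁)
    (if r then u₀ else u₁) (if r then u₁ else u₂) ∧
  CrossingRel c (if q then m₁ else m₀) (if q then m₂ else m₁)
    (if r then u₁ else u₀) (if r then u₂ else u₁)

-- The regions outside the triangle keep their colors. The color across the crossing `z` from the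
-- triangle is given by the sum condition of the middle strand, and the color of the new triangle by
-- that of the top strand; `triangleShift` puts these values into one formula for all strands. The
-- two sign hypotheses leave 16 of the 64 cases, and in each of them the claim is linear.
set_option maxHeartbeats 1600000 in
lemma TriangleRel.shift {a b c p q r : Bool} (h₁ : (q == a) = (r == b))
    (h₂ : (p == a) = (r == c)) {t₀ t₁ t₂ m₀ m₁ m₂ u₀ u₁ u₂ : SidePair G}
    (h : TriangleRel a b c p q r t₀ t₁ t₂ m₀ m₁ m₂ u₀ u₁ u₂) :
    TriangleRel a b c (!p) (!q) (!r) t₀ (triangleShift p t₀ t₁ t₂) t₂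
      m₀ (triangleShift q m₀ m₁ m₂) m₂ u₀ (triangleShift r u₀ u₁ u₂) u₂ := by
  obtain ⟨t₀₁, t₀₂⟩ := t₀
  obtain ⟨t₁₁, t₁₂⟩ := t₁
  obtain ⟨t₂₁, t₂₂⟩ := t₂
  obtain ⟨m₀₁, m₀₂⟩ := m₀
  obtain ⟨m₁₁, m₁₂⟩ := m₁
  obtain ⟨m₂₁, m₂₂⟩ := m₂
  obtain ⟨u₀₁, u₀₂⟩ := u₀
  obtain ⟨u₁₁, u₁₂⟩ := u₁
  obtain ⟨u₂₁, u₂₂⟩ := u₂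
  revert h₁ h₂
  cases a <;> cases b <;> cases c <;> cases p <;> cases q <;> cases r <;>
    simp only [beq_self_eq_true, Bool.true_eq_false, Bool.false_eq_true,
      IsEmpty.forall_iff, forall_const, Bool.not_true, Bool.not_false, Bool.true_beq, Bool.false_beq,
      TriangleRel, CrossingRel, CornersMatch, triangleShift, if_true, if_false, Prod.mk_add_mk,
      Prod.mk_sub_mk] at h ⊢ <;>
    and_intros <;> grind

end Crossing

/-! ### Colored walks

A coloring of the regions is encoded by the list of all passages together with the colors next to the
edge before and the edge after the passage. -/

/-- A passage together with the colors next to the edges before and after it. -/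
structure ColoredPass (G : Type*) where
  pass : Pass
  source : SidePair G
  target : SidePair G

section Walk

variable {G : Type*} [AddCommGroup G]

/-- The list `t` of colored passages is a path from `a` to `b`. -/
def IsPath {G : Type*} : SidePair G → List (ColoredPass G) → SidePair G → Prop
  | a, [], b => a = b
  | a, x :: t, b => x.source = a ∧ IsPath x.target t b

/-- The list `t` is a path from `a` to `b` with underlying code `w`. -/
def IsLift {G : Type*} (w : GaussCode) (a b : SidePair G) (t : List (ColoredPass G)) : Prop :=
  IsPath a t b ∧ t.map ColoredPass.pass = w

/-- The conditions at all crossings are satisfied. -/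
def Compatible (t : List (ColoredPass G)) : Prop :=
  ∀ x ∈ t, ∀ y ∈ t, x.pass.label = y.pass.label → x.pass.isOver = true → y.pass.isOver = false →
    CrossingRel x.pass.isPos x.source x.target y.source y.target

/-- The triple `x` describes a coloring of the regions of `w`: its components are the color at the
head, the colored passages, and the color at the leg. -/
def IsWalk (w : GaussCode) (x : G × List (ColoredPass G) × G) : Prop :=
  IsLift w (x.1, x.1) (x.2.2, x.2.2) x.2.1 ∧ Compatible x.2.1

lemma isPath_append {G : Type*} {a b : SidePair G} {s t : List (ColoredPass G)} :
    IsPath a (s ++ t) b ↔ ∃ m, IsPath a s m ∧ IsPath m t b := by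
  induction s generalizing a with
  | nil => simp [IsPath]
  | cons x s ih => simp [IsPath, ih, and_assoc]

lemma isLift_append {G : Type*} {u v : GaussCode} {a b : SidePair G} {t : List (ColoredPass G)} :
    IsLift (u ++ v) a b t ↔
      ∃ m s s', t = s ++ s' ∧ IsLift u a m s ∧ IsLift v m b s' := by
  constructor
  · rintro ⟨h, hw⟩
    obtain ⟨s, s', rfl, hs, hs'⟩ := List.map_eq_append_iff.1 hw
    obtain ⟨m, h, h'⟩ := isPath_append.1 h
    exact ⟨m, s, s', rfl, ⟨h, hs⟩, h', hs'⟩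
  · rintro ⟨m, s, s', rfl, ⟨h, hs⟩, h', hs'⟩
    exact ⟨isPath_append.2 ⟨m, h, h'⟩, by simp [hs, hs']⟩

lemma IsLift.append {G : Type*} {u v : GaussCode} {a m b : SidePair G}
    {s t : List (ColoredPass G)} (h : IsLift u a m s) (h' : IsLift v m b t) :
    IsLift (u ++ v) a b (s ++ t) :=
  isLift_append.2 ⟨m, s, t, rfl, h, h'⟩

lemma isPath_unique {G : Type*} {a b b' : SidePair G} {t : List (ColoredPass G)}
    (h : IsPath a t b) (h' : IsPath a t b') : b = b' := by
  induction t generalizing a with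
  | nil => exact h.symm.trans h'
  | cons x t ih => exact ih h.2 h'.2

lemma IsLift.length {G : Type*} {w : GaussCode} {a b : SidePair G} {t : List (ColoredPass G)}
    (h : IsLift w a b t) : t.length = w.length := by
  rw [← h.2, List.length_map]

lemma IsLift.pass_mem {G : Type*} {w : GaussCode} {a b : SidePair G} {t : List (ColoredPass G)}
    (h : IsLift w a b t) {x : ColoredPass G} (hx : x ∈ t) : x.pass ∈ w :=
  h.2 ▸ List.mem_map_of_mem hx

/-- The lift of `seg p α β` with colors `m`, `n`, `l`. -/
def segLift {G : Type*} (p : Bool) (α β : Pass) (m n l : SidePair G) : List (ColoredPass G) :=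
  if p then [⟨α, m, n⟩, ⟨β, n, l⟩] else [⟨β, m, n⟩, ⟨α, n, l⟩]

lemma isLift_seg {G : Type*} {p : Bool} {α β : Pass} {m l : SidePair G}
    {t : List (ColoredPass G)} :
    IsLift (seg p α β) m l t ↔ ∃ n, t = segLift p α β m n l := by
  constructor
  · rintro ⟨h, h'⟩
    cases p <;> simp only [seg, Bool.false_eq_true, if_true, if_false] at h' <;>
    · obtain ⟨⟨x, a, b⟩, t, rfl, rfl, ht⟩ := List.map_eq_cons_iff.1 h'
      obtain ⟨⟨y, a', b'⟩, t, rfl, rfl, ht'⟩ := List.map_eq_cons_iff.1 ht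
      obtain rfl := List.map_eq_nil_iff.1 ht'
      obtain ⟨h₁, h₂, h₃⟩ := h
      simp only at h₁ h₂
      subst h₁ h₂
      exact ⟨_, by simp only [segLift]; rw [← h₃]; rfl⟩
  · rintro ⟨n, rfl⟩
    cases p <;> simp [IsLift, segLift, IsPath, seg]

lemma segLift_lift {G : Type*} (p : Bool) (α β : Pass) (m n l : SidePair G) :
    IsLift (seg p α β) m l (segLift p α β m n l) :=
  isLift_seg.2 ⟨n, rfl⟩

lemma length_segLift {G : Type*} (p : Bool) (α β : Pass) (m n l : SidePair G) :
    (segLift p α β m n l).length = 2 := by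
  cases p <;> rfl

lemma segLift_inj {G : Type*} {p : Bool} {α β : Pass} {m n l m' n' l' : SidePair G}
    (h : segLift p α β m n l = segLift p α β m' n' l') : m = m' ∧ n = n' ∧ l = l' := by
  cases p <;> simp [segLift] at h <;> tauto

lemma Compatible.of_mem {s t : List (ColoredPass G)} (h : Compatible t) (hst : ∀ x ∈ s, x ∈ t) :
    Compatible s :=
  fun x hx y hy => h x (hst x hx) y (hst y hy)

/-- Conditions only relate passages with equal labels, so they decouple. This is the locality behind
all the moves and behind products; as only membership matters, the order of the passages in `t` is
free. -/
lemma compatible_of_disjoint {s s' t : List (ColoredPass G)}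
    (ht : ∀ x, x ∈ t ↔ x ∈ s ∨ x ∈ s')
    (hd : ∀ x ∈ s, ∀ y ∈ s', x.pass.label ≠ y.pass.label) :
    Compatible t ↔ Compatible s ∧ Compatible s' := by
  refine ⟨fun h => ⟨h.of_mem fun x hx => (ht x).2 (.inl hx),
    h.of_mem fun x hx => (ht x).2 (.inr hx)⟩, fun ⟨h, h'⟩ x hx y hy e => ?_⟩
  rcases (ht x).1 hx with hx | hx <;> rcases (ht y).1 hy with hy | hy
  · exact h x hx y hy e
  · exact absurd e (hd x hx y hy)
  · exact absurd e.symm (hd y hy x hx)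
  · exact h' x hx y hy e

/-- If some of the passages of a code already go twice through each of their crossings, then the other
passages go through other crossings. -/
lemma IsValid.label_ne {w u v : GaussCode} (hw : w.IsValid) (huv : (u ++ v).Perm w)
    (hu : ∀ p ∈ u, p.swap ∈ u) {p q : Pass} (hp : p ∈ u) (hq : q ∈ v) : p.label ≠ q.label := by
  intro h
  have hpos := hw.2.2 p (huv.subset (List.mem_append_left _ hp)) q
    (huv.subset (List.mem_append_right _ hq)) h
  have hd := List.disjoint_of_nodup_append (huv.nodup_iff.2 hw.1)
  by_cases ho : p.isOver = q.isOver
  · exact hd hp ((Pass.ext h ho hpos : p = q) ▸ hq)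
  · refine hd (hu p hp) ((Pass.ext h ?_ hpos : p.swap = q) ▸ hq)
    simp only [Pass.swap]
    revert ho
    cases p.isOver <;> cases q.isOver <;> simp

/-- Bijections are given as relations because the cutting of a walk at the place of a move is only
available existentially. -/
lemma card_subtype_eq_of_rel {α β : Type*} {P : α → Prop} {Q : β → Prop} (R : α → β → Prop)
    (h₁ : ∀ x, P x → ∃ y, Q y ∧ R x y) (h₂ : ∀ y, Q y → ∃ x, P x ∧ R x y)
    (h₃ : ∀ x y y', R x y → R x y' → y = y') (h₄ : ∀ x x' y, R x y → R x' y → x = x') :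
    Nat.card {x // P x} = Nat.card {y // Q y} := by
  choose f hf hf' using h₁
  refine Nat.card_congr (Equiv.ofBijective (fun x => ⟨f x.1 x.2, hf x.1 x.2⟩) ⟨?_, ?_⟩)
  · rintro ⟨x, hx⟩ ⟨x', hx'⟩ h
    have h : f x hx = f x' hx' := congrArg Subtype.val h
    exact Subtype.ext (h₄ _ _ _ (hf' x hx) (h ▸ hf' x' hx'))
  · rintro ⟨y, hy⟩
    obtain ⟨x, hx, hxy⟩ := h₂ y hy
    exact ⟨⟨x, hx⟩, Subtype.ext (h₃ _ _ _ (hf' x hx) hxy)⟩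

variable (G) in
/-- The number of colorings of the regions. -/
noncomputable def walkCount (w : GaussCode) : ℕ :=
  Nat.card {x : G × List (ColoredPass G) × G // IsWalk w x}

/-! ### Renaming of crossings. -/

lemma walkCount_relabel (w : GaussCode) {f : ℕ → ℕ} (hf : Function.Injective f) :
    walkCount G w = walkCount G (w.map (Pass.relabel f)) := by
  let F : ColoredPass G → ColoredPass G := fun x => ⟨x.pass.relabel f, x.source, x.target⟩
  have hF : Function.Injective F := by
    rintro ⟨⟨k, o, s⟩, a, b⟩ ⟨⟨k', o', s'⟩, a', b'⟩ h
    simp only [F, Pass.relabel, ColoredPass.mk.injEq, Pass.mk.injEq] at h ⊢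
    exact ⟨⟨hf h.1.1, h.1.2⟩, h.2⟩
  have hpath : ∀ (t : List (ColoredPass G)) a b, IsPath a (t.map F) b ↔ IsPath a t b := by
    intro t
    induction t with
    | nil => simp [IsPath]
    | cons x t ih => simp [IsPath, ih, F]
  have hcomp : ∀ t : List (ColoredPass G), Compatible (t.map F) ↔ Compatible t := by
    intro t
    simp [Compatible, F, Pass.relabel, hf.eq_iff]
  refine card_subtype_eq_of_rel (fun x y => y = (x.1, x.2.1.map F, x.2.2)) ?_ ?_ ?_ ?_
  · rintro ⟨a, t, b⟩ ⟨⟨h, h'⟩, hc⟩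
    refine ⟨_, ⟨⟨(hpath _ _ _).2 h, ?_⟩, (hcomp _).2 hc⟩, rfl⟩
    simp only at h'
    simp [← h', F, Function.comp_def]
  · rintro ⟨a, t, b⟩ ⟨⟨h, h'⟩, hc⟩
    simp only at h h' hc
    -- `f` need not be surjective, so the preimage of `t` takes its passages from `w` and its colors
    -- from `t`.
    have : ∃ t' : List (ColoredPass G), t = t'.map F ∧ t'.map ColoredPass.pass = w := by
      clear h hc
      induction w generalizing t with
      | nil => exact ⟨[], by simpa using h', rfl⟩
      | cons p w ih =>
        obtain ⟨x, t, rfl, hx, ht⟩ := List.map_eq_cons_iff.1 h'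
        obtain ⟨t', rfl, ht'⟩ := ih t ht
        exact ⟨⟨p, x.source, x.target⟩ :: t', by simp [F, ← hx], by simp [ht']⟩
    obtain ⟨t, rfl, ht⟩ := this
    exact ⟨(a, t, b), ⟨⟨(hpath _ _ _).1 h, ht⟩, (hcomp _).1 hc⟩, rfl⟩
  · rintro x y y' rfl rfl
    rfl
  · rintro ⟨a, t, b⟩ ⟨a', t', b'⟩ y rfl h
    simp only [Prod.mk.injEq] at h
    simp [h.1, h.2.2, hF.list_map h.2.1]

/-! ### The first Reidemeister move. -/

lemma compatible_kink (k : ℕ) (o s : Bool) (m n l : SidePair G) :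
    Compatible (segLift true ⟨k, o, s⟩ ⟨k, !o, s⟩ m n l) ↔ n = m.swap ∧ l = m := by
  cases o
  · rw [← crossingRel_kink' s]
    simp [Compatible, segLift]
  · rw [← crossingRel_kink s]
    simp [Compatible, segLift]

lemma walkCount_kink (A B : GaussCode) (k : ℕ) (o s : Bool)
    (hw : IsValid (A ++ [⟨k, o, s⟩, ⟨k, !o, s⟩] ++ B)) :
    walkCount G (A ++ B) = walkCount G (A ++ [⟨k, o, s⟩, ⟨k, !o, s⟩] ++ B) := by
  -- Validity of the longer code forces the label of the kink to be new.
  have hd : ∀ p ∈ A ++ B, k ≠ p.label := fun p hp =>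
    hw.label_ne (u := [⟨k, o, s⟩, ⟨k, !o, s⟩]) (v := A ++ B) (p := ⟨k, o, s⟩)
      (by rw [List.append_assoc]; exact List.perm_append_comm_assoc _ _ _)
      (by simp [Pass.swap]) (by simp) hp
  have hc : ∀ {a m b n l : SidePair G} {s₁ s₂ : List (ColoredPass G)}, IsLift A a m s₁ →
      IsLift B l b s₂ →
      (Compatible (s₁ ++ segLift true ⟨k, o, s⟩ ⟨k, !o, s⟩ m n l ++ s₂) ↔
        (n = m.swap ∧ l = m) ∧ Compatible (s₁ ++ s₂)) := by
    intro a m b n l s₁ s₂ h₁ h₂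
    rw [← compatible_kink k o s]
    refine compatible_of_disjoint (by simp; tauto) ?_
    intro x hx y hy
    have hx' : x.pass.label = k := by
      simp only [segLift, if_true, List.mem_cons, List.not_mem_nil, or_false] at hx
      rcases hx with rfl | rfl <;> rfl
    rw [hx']
    apply hd
    rcases List.mem_append.1 hy with hy | hy
    · exact List.mem_append_left _ (h₁.pass_mem hy)
    · exact List.mem_append_right _ (h₂.pass_mem hy)
  refine card_subtype_eq_of_rel (fun x y => ∃ m s₁ s₂, IsLift A (x.1, x.1) m s₁ ∧
    x.2.1 = s₁ ++ s₂ ∧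
    y = (x.1, s₁ ++ segLift true ⟨k, o, s⟩ ⟨k, !o, s⟩ m m.swap m ++ s₂, x.2.2)) ?_ ?_ ?_ ?_
  · rintro ⟨a, t, b⟩ ⟨h, h'⟩
    obtain ⟨m, s₁, s₂, rfl, h₁, h₂⟩ := isLift_append.1 h
    exact ⟨(a, s₁ ++ segLift true ⟨k, o, s⟩ ⟨k, !o, s⟩ m m.swap m ++ s₂, b), ⟨(h₁.append (segLift_lift true ⟨k, o, s⟩ ⟨k, !o, s⟩ _ _ _)).append h₂,
      (hc h₁ h₂).2 ⟨⟨rfl, rfl⟩, h'⟩⟩, m, s₁, s₂, h₁, rfl, rfl⟩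
  · rintro ⟨a, t, b⟩ ⟨h, h'⟩
    obtain ⟨l, s₁, s₂, rfl, h₁, h₂⟩ := isLift_append.1 h
    obtain ⟨m, s₁, s₃, rfl, h₁, h₃⟩ := isLift_append.1 h₁
    obtain ⟨n, rfl⟩ := (isLift_seg (p := true)).1 h₃
    obtain ⟨⟨rfl, rfl⟩, hs⟩ := (hc h₁ h₂).1 h'
    exact ⟨(a, s₁ ++ s₂, b), ⟨h₁.append h₂, hs⟩, l, s₁, s₂, h₁, rfl, rfl⟩
  · rintro ⟨a, t, b⟩ y y' ⟨m, s₁, s₂, h₁, e, rfl⟩ ⟨m', s₁', s₂', h₁', e', rfl⟩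
    simp only at e e' h₁ h₁'
    subst e
    -- The place of the cut is determined by the length of `A`.
    obtain ⟨rfl, rfl⟩ := List.append_inj e' (h₁.length.trans h₁'.length.symm)
    rw [isPath_unique h₁.1 h₁'.1]
  · rintro ⟨a, t, b⟩ ⟨a', t', b'⟩ y ⟨m, s₁, s₂, h₁, e, rfl⟩ ⟨m', s₁', s₂', h₁', e', h⟩
    simp only [Prod.mk.injEq] at e e' h₁ h₁' h
    obtain ⟨rfl, h, rfl⟩ := h
    subst e e'
    obtain ⟨hs, rfl⟩ := List.append_inj h
      (by simp [h₁.length, h₁'.length, length_segLift])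
    obtain ⟨rfl, -⟩ := List.append_inj hs (h₁.length.trans h₁'.length.symm)
    rfl

/-! ### Walks as colorings of the regions. -/

/-- The colors next to the edges that a path starting at `a` goes through. -/
def edgeColor {G : Type*} : SidePair G → List (ColoredPass G) → ℕ → SidePair G
  | a, _, 0 => a
  -- Default value beyond the last edge; an edge has index at most the length of the path.
  | a, [], _ + 1 => a
  | _, x :: t, n + 1 => edgeColor x.target t n

lemma edgeColor_length {G : Type*} {a m : SidePair G} {s : List (ColoredPass G)}
    (h : IsPath a s m) (t : List (ColoredPass G)) : edgeColor a (s ++ t) s.length = m := by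
  induction s generalizing a with
  | nil => obtain rfl := h; cases t <;> rfl
  | cons x s ih => exact ih h.2

lemma IsPath.getElem {G : Type*} {a b : SidePair G} {t : List (ColoredPass G)} (h : IsPath a t b)
    (i : ℕ) (hi : i < t.length) :
    t[i].source = edgeColor a t i ∧ t[i].target = edgeColor a t (i + 1) := by
  induction t generalizing a i with
  | nil => simp at hi
  | cons x t ih =>
    cases i with
    | zero => exact ⟨h.1, by cases t <;> rfl⟩
    | succ i => exact ih h.2 i (by simpa using hi)

lemma IsPath.edgeColor_last {G : Type*} {a b : SidePair G} {t : List (ColoredPass G)}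
    (h : IsPath a t b) : edgeColor a t t.length = b := by
  simpa using edgeColor_length h []

/-- The corner relations are among the conditions at the crossings, and the relations at the head
and the leg hold because a walk starts and ends with a pair of equal colors. Hence the side colors
of a walk descend to the regions. -/
lemma get_edgeColor_eq_of_regionRel {w : GaussCode} (hw : w.IsValid)
    {x : G × List (ColoredPass G) × G} (hx : IsWalk w x) {p q : w.Side} (h : w.RegionRel p q) :
    (edgeColor (x.1, x.1) x.2.1 p.1).get p.2 = (edgeColor (x.1, x.1) x.2.1 q.1).get q.2 := by
  obtain ⟨a, t, b⟩ := x
  obtain ⟨⟨hp, rfl⟩, hc⟩ := hx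
  simp only at hp hc hw h ⊢
  have key : ∀ i j, Crosses (t.map ColoredPass.pass) i j →
      CornersMatch (edgeColor (a, a) t i) (edgeColor (a, a) t (i + 1))
        (edgeColor (a, a) t j) (edgeColor (a, a) t (j + 1)) := by
    rintro ⟨i, hi⟩ ⟨j, hj⟩ ⟨h₁, h₂, h₃⟩
    have hs := hw.2.2 _ (List.getElem_mem hi) _ (List.getElem_mem hj) h₁
    simp only [List.length_map] at hi hj
    simp only [Fin.getElem_fin, List.getElem_map] at h₁ h₂ h₃ hs
    obtain ⟨ei, ei'⟩ := hp.getElem i hi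
    obtain ⟨ej, ej'⟩ := hp.getElem j hj
    simp only
    rw [← ei, ← ei', ← ej, ← ej']
    -- In `Crosses` the passage `i` is the over-passage at a positive crossing and the under-passage
    -- at a negative one, so `hc` is applied with exchanged roles in the second case.
    cases hpos : t[i].pass.isPos with
    | true =>
      rw [hpos] at h₂ hs
      rw [← hs] at h₃
      have := (hc _ (List.getElem_mem hi) _ (List.getElem_mem hj) h₁ h₂
        (by simpa using h₃)).2
      rwa [hpos, if_pos rfl] at this
    | false =>
      rw [hpos] at h₂ hs
      rw [← hs] at h₃
      have := (hc _ (List.getElem_mem hj) _ (List.getElem_mem hi) h₁.symm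
        (by simpa using h₃) h₂).2
      rwa [← hs, if_neg (by simp)] at this
  cases h with
  | corner p q hpq =>
    cases hpq with
    | north i j h => exact (key i j h).1
    | west i j h => exact (key i j h).2.1
    | south i j h => exact (key i j h).2.2.1
    | east i j h => exact (key i j h).2.2.2
  | head => cases t <;> rfl
  | leg =>
    have : edgeColor (a, a) t (Fin.last (t.map ColoredPass.pass).length) = (b, b) := by
      simpa using hp.edgeColor_last
    simp only [this]
    rfl

/-- This turns the geometric hypothesis of the second move, and the statement `mul_joint` about
products, into equalities of colors. -/
lemma get_edgeColor_eq_of_region {w : GaussCode} (hw : w.IsValid)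
    {x : G × List (ColoredPass G) × G} (hx : IsWalk w x) {e f : w.Edge} {s s' : Bool}
    (h : w.region e s = w.region f s') :
    (edgeColor (x.1, x.1) x.2.1 e).get s = (edgeColor (x.1, x.1) x.2.1 f).get s' :=
  congrArg (Quot.lift (fun p : w.Side => (edgeColor (x.1, x.1) x.2.1 p.1).get p.2)
    fun _ _ => get_edgeColor_eq_of_regionRel hw hx) h

/-! ### The second Reidemeister move. -/

lemma compatible_bigon {k l : ℕ} (hkl : k ≠ l) (o s d : Bool) (m n c m' n' c' : SidePair G) :
    Compatible (segLift true ⟨k, o, s⟩ ⟨l, o, !s⟩ m n c ++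
      segLift d ⟨k, !o, s⟩ ⟨l, !o, !s⟩ m' n' c') ↔
    c = m ∧ c' = m' ∧ m.get (d != (o == s)) = m'.get (o == s) ∧
      n = SidePair.mk (d != (o == s)) (m'.get (!(o == s)))
        (bigonColor o (d != (o == s)) (o == s) m m') ∧
      n' = SidePair.mk (o == s) (m.get (!(d != (o == s))))
        (bigonColor o (d != (o == s)) (o == s) m m') := by
  rw [← strandRel_bigon]
  cases o <;> cases d <;> simp [Compatible, segLift, StrandRel, hkl, hkl.symm] 
  exact and_comm

lemma walkCount_bigon (A B C : GaussCode) (k l : ℕ) (o s d : Bool) (e f : (A ++ B ++ C).Edge)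
    (he : (e : ℕ) = A.length) (hf : (f : ℕ) = A.length + B.length)
    (h : (A ++ B ++ C).region e (d != (o == s)) = (A ++ B ++ C).region f (o == s))
    (hv : (A ++ B ++ C).IsValid)
    (hw : IsValid (A ++ [⟨k, o, s⟩, ⟨l, o, !s⟩] ++ B ++ seg d ⟨k, !o, s⟩ ⟨l, !o, !s⟩ ++ C)) :
    walkCount G (A ++ B ++ C) = walkCount G
      (A ++ [⟨k, o, s⟩, ⟨l, o, !s⟩] ++ B ++ seg d ⟨k, !o, s⟩ ⟨l, !o, !s⟩ ++ C) := by
  classical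
  set P : GaussCode := seg true ⟨k, o, s⟩ ⟨l, o, !s⟩ with hP
  set Q : GaussCode := seg d ⟨k, !o, s⟩ ⟨l, !o, !s⟩ with hQ
  have hP' : [Pass.mk k o s, Pass.mk l o !s] = P := rfl
  rw [hP'] at hw ⊢
  have hmem : ∀ p, p ∈ Q ↔ p = ⟨k, !o, s⟩ ∨ p = ⟨l, !o, !s⟩ := by
    intro p
    cases d <;> simp [hQ, seg, or_comm]
  -- The two crossings have opposite signs, which one label cannot carry in a valid code.
  have hkl : k ≠ l := by
    intro hkl
    have := hw.2.2 ⟨k, o, s⟩ (by simp [hP, seg]) ⟨l, o, !s⟩ (by simp [hP, seg]) hkl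
    revert this
    cases s <;> simp
  have hd : ∀ p ∈ P ++ Q, ∀ q ∈ A ++ B ++ C, p.label ≠ q.label := fun p hp q hq =>
    hw.label_ne (u := P ++ Q) (v := A ++ B ++ C)
      (List.perm_iff_count.2 fun x => by simp only [List.count_append]; omega)
      (by
        intro p hp
        simp only [List.mem_append, hmem, hP, seg, if_true, List.mem_cons, List.not_mem_nil,
          or_false] at hp ⊢
        rcases hp with (rfl | rfl) | rfl | rfl <;> simp [Pass.swap]) hp hq
  have hc : ∀ {a m n c m' n' c' b : SidePair G} {s₁ s₂ s₃ : List (ColoredPass G)},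
      IsLift A a m s₁ → IsLift B c m' s₂ → IsLift C c' b s₃ →
      (Compatible (s₁ ++ segLift true ⟨k, o, s⟩ ⟨l, o, !s⟩ m n c ++ s₂ ++
        segLift d ⟨k, !o, s⟩ ⟨l, !o, !s⟩ m' n' c' ++ s₃) ↔
        (c = m ∧ c' = m' ∧ m.get (d != (o == s)) = m'.get (o == s) ∧
          n = SidePair.mk (d != (o == s)) (m'.get (!(o == s)))
            (bigonColor o (d != (o == s)) (o == s) m m') ∧
          n' = SidePair.mk (o == s) (m.get (!(d != (o == s))))
            (bigonColor o (d != (o == s)) (o == s) m m')) ∧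
        Compatible (s₁ ++ s₂ ++ s₃)) := by
    intro a m n c m' n' c' b s₁ s₂ s₃ h₁ h₂ h₃
    rw [← compatible_bigon hkl]
    refine compatible_of_disjoint (by simp only [List.mem_append]; tauto) ?_
    intro x hx y hy
    refine hd _ ?_ _ ?_
    · rcases List.mem_append.1 hx with hx | hx
      · exact List.mem_append_left _ ((segLift_lift _ _ _ _ _ _).pass_mem hx)
      · exact List.mem_append_right _ ((segLift_lift _ _ _ _ _ _).pass_mem hx)
    · simp only [List.mem_append] at hy ⊢
      rcases hy with (hy | hy) | hy
      · exact .inl (.inl (h₁.pass_mem hy))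
      · exact .inl (.inr (h₂.pass_mem hy))
      · exact .inr (h₃.pass_mem hy)
  refine card_subtype_eq_of_rel (fun x y => ∃ m m' s₁ s₂ s₃, IsLift A (x.1, x.1) m s₁ ∧
    IsLift B m m' s₂ ∧ x.2.1 = s₁ ++ s₂ ++ s₃ ∧
    y = (x.1, s₁ ++ segLift true ⟨k, o, s⟩ ⟨l, o, !s⟩ m
        (SidePair.mk (d != (o == s)) (m'.get (!(o == s)))
          (bigonColor o (d != (o == s)) (o == s) m m')) m ++ s₂ ++
      segLift d ⟨k, !o, s⟩ ⟨l, !o, !s⟩ m'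
        (SidePair.mk (o == s) (m.get (!(d != (o == s))))
          (bigonColor o (d != (o == s)) (o == s) m m')) m' ++ s₃, x.2.2)) ?_ ?_ ?_ ?_
  · rintro ⟨a, t, b⟩ hx
    have hx' := hx
    obtain ⟨hl, hx'⟩ := hx'
    obtain ⟨m', s₁₂, s₃, rfl, h₁₂, h₃⟩ := isLift_append.1 hl
    obtain ⟨m, s₁, s₂, rfl, h₁, h₂⟩ := isLift_append.1 h₁₂
    -- The two edges border a common region, so the facing colors agree; without this the bigon
    -- could not be colored.
    have hm := get_edgeColor_eq_of_region hv hx h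
    have e₁ : edgeColor (a, a) (s₁ ++ s₂ ++ s₃) e = m := by
      rw [he, ← h₁.length, List.append_assoc]
      exact edgeColor_length h₁.1 _
    have e₂ : edgeColor (a, a) (s₁ ++ s₂ ++ s₃) f = m' := by
      rw [hf, ← h₁.length, ← h₂.length, ← List.length_append]
      exact edgeColor_length h₁₂.1 _
    simp only [e₁, e₂] at hm
    refine ⟨_, ⟨?_, ?_⟩, m, m', s₁, s₂, s₃, h₁, h₂, rfl, rfl⟩
    · exact (((h₁.append (segLift_lift true ⟨k, o, s⟩ ⟨l, o, !s⟩ _ _ _)).append h₂).append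
        (segLift_lift d ⟨k, !o, s⟩ ⟨l, !o, !s⟩ _ _ _)).append h₃
    · exact (hc h₁ h₂ h₃).2 ⟨⟨rfl, rfl, hm, rfl, rfl⟩, hx'⟩
  · rintro ⟨a, t, b⟩ ⟨hl, hx⟩
    obtain ⟨c', t, s₃, rfl, hl, h₃⟩ := isLift_append.1 hl
    obtain ⟨m', t, t₂, rfl, hl, ht₂⟩ := isLift_append.1 hl
    obtain ⟨c, t, s₂, rfl, hl, h₂⟩ := isLift_append.1 hl
    obtain ⟨m, s₁, t₁, rfl, h₁, ht₁⟩ := isLift_append.1 hl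
    obtain ⟨n, rfl⟩ := isLift_seg.1 ht₁
    obtain ⟨n', rfl⟩ := isLift_seg.1 ht₂
    -- When the bigon is removed, the equality of the facing colors is not needed to get a walk.
    obtain ⟨⟨rfl, rfl, -, rfl, rfl⟩, hs⟩ := (hc h₁ h₂ h₃).1 hx
    exact ⟨(a, s₁ ++ s₂ ++ s₃, b), ⟨(h₁.append h₂).append h₃, hs⟩, c, c', s₁, s₂, s₃, h₁, h₂,
      rfl, rfl⟩
  · rintro ⟨a, t, b⟩ y y' ⟨m, m', s₁, s₂, s₃, h₁, h₂, e, rfl⟩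
      ⟨c, c', t₁, t₂, t₃, h₁', h₂', e', rfl⟩
    simp only at e e' h₁ h₁'
    subst e
    obtain ⟨e₁, rfl⟩ := List.append_inj e' (by
      simp [h₁.length, h₁'.length, h₂.length, h₂'.length])
    obtain ⟨rfl, rfl⟩ := List.append_inj e₁ (h₁.length.trans h₁'.length.symm)
    obtain rfl := isPath_unique h₁.1 h₁'.1
    rw [isPath_unique h₂.1 h₂'.1]
  · rintro ⟨a, t, b⟩ ⟨a', t', b'⟩ y ⟨m, m', s₁, s₂, s₃, h₁, h₂, e, rfl⟩
      ⟨c, c', t₁, t₂, t₃, h₁', h₂', e', h⟩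
    simp only [Prod.mk.injEq] at e e' h₁ h₁' h
    obtain ⟨rfl, h, rfl⟩ := h
    subst e e'
    obtain ⟨e₁, rfl⟩ := List.append_inj h
      (by simp [h₁.length, h₁'.length, h₂.length, h₂'.length, length_segLift])
    obtain ⟨e₂, -⟩ := List.append_inj e₁
      (by simp [h₁.length, h₁'.length, h₂.length, h₂'.length, length_segLift])
    obtain ⟨e₃, rfl⟩ := List.append_inj e₂
      (by simp [h₁.length, h₁'.length, length_segLift])
    obtain ⟨rfl, -⟩ := List.append_inj e₃ (h₁.length.trans h₁'.length.symm)
    rfl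

/-! ### The third Reidemeister move. -/

lemma compatible_triangle {x y z : ℕ} (hxy : x ≠ y) (hxz : x ≠ z) (hyz : y ≠ z)
    (a b c p q r : Bool) (t₀ t₁ t₂ m₀ m₁ m₂ u₀ u₁ u₂ : SidePair G) :
    Compatible (segLift p ⟨x, true, a⟩ ⟨y, true, b⟩ t₀ t₁ t₂ ++
      segLift q ⟨x, false, a⟩ ⟨z, true, c⟩ m₀ m₁ m₂ ++
      segLift r ⟨y, false, b⟩ ⟨z, false, c⟩ u₀ u₁ u₂) ↔
    TriangleRel a b c p q r t₀ t₁ t₂ m₀ m₁ m₂ u₀ u₁ u₂ := by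
  cases p <;> cases q <;> cases r <;>
    simp [Compatible, segLift, TriangleRel, hxy, hxz, hyz, hxy.symm, hxz.symm, hyz.symm] <;> tauto

/-- The colored passages of `y` arise from those of `x` by flipping three segments. -/
def FlipRel (A B C : GaussCode) (o₁ o₂ o₃ : Bool) (α₁ β₁ α₂ β₂ α₃ β₃ : Pass)
    (x y : G × List (ColoredPass G) × G) : Prop :=
  ∃ (s₁ s₂ s₃ s₄ : List (ColoredPass G)) (m₁ n₁ l₁ m₂ n₂ l₂ m₃ n₃ l₃ : SidePair G),
    s₁.length = A.length ∧ s₂.length = B.length ∧ s₃.length = C.length ∧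
    x.2.1 = s₁ ++ segLift o₁ α₁ β₁ m₁ n₁ l₁ ++ s₂ ++ segLift o₂ α₂ β₂ m₂ n₂ l₂ ++ s₃ ++
      segLift o₃ α₃ β₃ m₃ n₃ l₃ ++ s₄ ∧
    y = (x.1, s₁ ++ segLift (!o₁) α₁ β₁ m₁ (triangleShift o₁ m₁ n₁ l₁) l₁ ++ s₂ ++
      segLift (!o₂) α₂ β₂ m₂ (triangleShift o₂ m₂ n₂ l₂) l₂ ++ s₃ ++
      segLift (!o₃) α₃ β₃ m₃ (triangleShift o₃ m₃ n₃ l₃) l₃ ++ s₄, x.2.2)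

variable {A B C E : GaussCode} {o₁ o₂ o₃ : Bool} {α₁ β₁ α₂ β₂ α₃ β₃ : Pass}

/-- Shifting the middle colors is undone by the shift for the opposite order, so the construction
for one direction of the move also serves as its inverse. -/
lemma FlipRel.symm {x y : G × List (ColoredPass G) × G}
    (h : FlipRel A B C o₁ o₂ o₃ α₁ β₁ α₂ β₂ α₃ β₃ x y) :
    FlipRel A B C (!o₁) (!o₂) (!o₃) α₁ β₁ α₂ β₂ α₃ β₃ y x := by
  obtain ⟨a, t, b⟩ := x
  obtain ⟨s₁, s₂, s₃, s₄, m₁, n₁, l₁, m₂, n₂, l₂, m₃, n₃, l₃, h₁, h₂, h₃, h, rfl⟩ := h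
  refine ⟨s₁, s₂, s₃, s₄, m₁, _, l₁, m₂, _, l₂, m₃, _, l₃, h₁, h₂, h₃, rfl, ?_⟩
  simp only [Bool.not_not, triangleShift_triangleShift]
  simp only at h
  rw [h]

/-- The lengths of `A`, `B`, `C`, and the length 2 of each segment, determine the decomposition of
the list. -/
lemma FlipRel.unique {x y y' : G × List (ColoredPass G) × G}
    (h : FlipRel A B C o₁ o₂ o₃ α₁ β₁ α₂ β₂ α₃ β₃ x y)
    (h' : FlipRel A B C o₁ o₂ o₃ α₁ β₁ α₂ β₂ α₃ β₃ x y') : y = y' := by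
  obtain ⟨a, t, b⟩ := x
  obtain ⟨s₁, s₂, s₃, s₄, m₁, n₁, l₁, m₂, n₂, l₂, m₃, n₃, l₃, h₁, h₂, h₃, h, rfl⟩ := h
  obtain ⟨s₁', s₂', s₃', s₄', m₁', n₁', l₁', m₂', n₂', l₂', m₃', n₃', l₃', h₁', h₂', h₃', h', rfl⟩ :=
    h'
  simp only at h h'
  subst h
  obtain ⟨e₆, rfl⟩ := List.append_inj h' (by simp [h₁, h₂, h₃, h₁', h₂', h₃', length_segLift])
  obtain ⟨e₅, f₃⟩ := List.append_inj e₆ (by simp [h₁, h₂, h₃, h₁', h₂', h₃', length_segLift])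
  obtain ⟨e₄, rfl⟩ := List.append_inj e₅ (by simp [h₁, h₂, h₁', h₂', length_segLift])
  obtain ⟨e₃, f₂⟩ := List.append_inj e₄ (by simp [h₁, h₂, h₁', h₂', length_segLift])
  obtain ⟨e₂, rfl⟩ := List.append_inj e₃ (by simp [h₁, h₁', length_segLift])
  obtain ⟨rfl, f₁⟩ := List.append_inj e₂ (by rw [h₁, h₁'])
  obtain ⟨rfl, rfl, rfl⟩ := segLift_inj f₁
  obtain ⟨rfl, rfl, rfl⟩ := segLift_inj f₂
  obtain ⟨rfl, rfl, rfl⟩ := segLift_inj f₃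
  rfl

/-- By `hd` the triangle shares no label with the rest of the code, so compatibility splits into a
condition on the three segments, handled by `hc`, and a condition that the flip does not touch. -/
lemma exists_flipRel
    (hd : ∀ p ∈ seg o₁ α₁ β₁ ++ seg o₂ α₂ β₂ ++ seg o₃ α₃ β₃, ∀ q ∈ A ++ B ++ C ++ E,
      p.label ≠ q.label)
    (hc : ∀ m₁ n₁ l₁ m₂ n₂ l₂ m₃ n₃ l₃ : SidePair G,
      Compatible (segLift o₁ α₁ β₁ m₁ n₁ l₁ ++ segLift o₂ α₂ β₂ m₂ n₂ l₂ ++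
        segLift o₃ α₃ β₃ m₃ n₃ l₃) →
      Compatible (segLift (!o₁) α₁ β₁ m₁ (triangleShift o₁ m₁ n₁ l₁) l₁ ++
        segLift (!o₂) α₂ β₂ m₂ (triangleShift o₂ m₂ n₂ l₂) l₂ ++
        segLift (!o₃) α₃ β₃ m₃ (triangleShift o₃ m₃ n₃ l₃) l₃))
    (x : G × List (ColoredPass G) × G)
    (hx : IsWalk (A ++ seg o₁ α₁ β₁ ++ B ++ seg o₂ α₂ β₂ ++ C ++ seg o₃ α₃ β₃ ++ E) x) :
    ∃ y, IsWalk (A ++ seg (!o₁) α₁ β₁ ++ B ++ seg (!o₂) α₂ β₂ ++ C ++ seg (!o₃) α₃ β₃ ++ E) y ∧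
      FlipRel A B C o₁ o₂ o₃ α₁ β₁ α₂ β₂ α₃ β₃ x y := by
  obtain ⟨a, t, b⟩ := x
  obtain ⟨hl, hx⟩ := hx
  obtain ⟨l₃, t, s₄, rfl, hl, h₄⟩ := isLift_append.1 hl
  obtain ⟨m₃, t, t₃, rfl, hl, ht₃⟩ := isLift_append.1 hl
  obtain ⟨l₂, t, s₃, rfl, hl, h₃⟩ := isLift_append.1 hl
  obtain ⟨m₂, t, t₂, rfl, hl, ht₂⟩ := isLift_append.1 hl
  obtain ⟨l₁, t, s₂, rfl, hl, h₂⟩ := isLift_append.1 hl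
  obtain ⟨m₁, s₁, t₁, rfl, h₁, ht₁⟩ := isLift_append.1 hl
  obtain ⟨n₁, rfl⟩ := isLift_seg.1 ht₁
  obtain ⟨n₂, rfl⟩ := isLift_seg.1 ht₂
  obtain ⟨n₃, rfl⟩ := isLift_seg.1 ht₃
  refine ⟨_, ⟨?_, ?_⟩, s₁, s₂, s₃, s₄, m₁, n₁, l₁, m₂, n₂, l₂, m₃, n₃, l₃, h₁.length, h₂.length,
    h₃.length, rfl, rfl⟩
  · exact (((((h₁.append (segLift_lift _ _ _ _ _ _)).append h₂).append
      (segLift_lift _ _ _ _ _ _)).append h₃).append (segLift_lift _ _ _ _ _ _)).append h₄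
  · have hs : ∀ o (α β : Pass) (m n l : SidePair G), ∀ x ∈ segLift o α β m n l,
        x.pass = α ∨ x.pass = β := by
      intro o α β m n l x hx
      cases o <;> simp only [segLift, Bool.false_eq_true, if_true, if_false, List.mem_cons,
        List.not_mem_nil, or_false] at hx <;> rcases hx with rfl | rfl <;> simp
    have hseg : ∀ o (α β : Pass), α ∈ seg o α β ∧ β ∈ seg o α β := by
      intro o α β
      cases o <;> simp [seg]
    have hdis : ∀ n₁' n₂' n₃' : SidePair G, ∀ o₁' o₂' o₃',
        ∀ x ∈ segLift o₁' α₁ β₁ m₁ n₁' l₁ ++ segLift o₂' α₂ β₂ m₂ n₂' l₂ ++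
          segLift o₃' α₃ β₃ m₃ n₃' l₃, ∀ y ∈ s₁ ++ s₂ ++ s₃ ++ s₄, x.pass.label ≠ y.pass.label := by
      intro n₁' n₂' n₃' o₁' o₂' o₃' x hx y hy
      apply hd
      · simp only [List.mem_append] at hx ⊢
        rcases hx with (hx | hx) | hx <;> rcases hs _ _ _ _ _ _ _ hx with e | e <;>
          simp [e, hseg]
      · simp only [List.mem_append] at hy ⊢
        rcases hy with ((hy | hy) | hy) | hy
        · exact .inl (.inl (.inl (h₁.pass_mem hy)))
        · exact .inl (.inl (.inr (h₂.pass_mem hy)))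
        · exact .inl (.inr (h₃.pass_mem hy))
        · exact .inr (h₄.pass_mem hy)
    obtain ⟨hx₁, hx₂⟩ := (compatible_of_disjoint (by simp only [List.mem_append]; tauto)
      (hdis n₁ n₂ n₃ o₁ o₂ o₃)).1 hx
    exact (compatible_of_disjoint (by simp only [List.mem_append]; tauto)
      (hdis _ _ _ (!o₁) (!o₂) (!o₃))).2 ⟨hc _ _ _ _ _ _ _ _ _ hx₁, hx₂⟩

lemma mem_seg_not {o : Bool} {α β p : Pass} : p ∈ seg (!o) α β ↔ p ∈ seg o α β := by
  cases o <;> simp [seg, or_comm]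

/-- The parameter `d` selects the direction: `false` is the flip itself and `true` is its inverse.
-/
lemma walkCount_flip
    (hd : ∀ p ∈ seg o₁ α₁ β₁ ++ seg o₂ α₂ β₂ ++ seg o₃ α₃ β₃, ∀ q ∈ A ++ B ++ C ++ E,
      p.label ≠ q.label)
    (hc : ∀ d : Bool, ∀ m₁ n₁ l₁ m₂ n₂ l₂ m₃ n₃ l₃ : SidePair G,
      Compatible (segLift (d ^^ o₁) α₁ β₁ m₁ n₁ l₁ ++ segLift (d ^^ o₂) α₂ β₂ m₂ n₂ l₂ ++
        segLift (d ^^ o₃) α₃ β₃ m₃ n₃ l₃) →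
      Compatible (segLift (!(d ^^ o₁)) α₁ β₁ m₁ (triangleShift (d ^^ o₁) m₁ n₁ l₁) l₁ ++
        segLift (!(d ^^ o₂)) α₂ β₂ m₂ (triangleShift (d ^^ o₂) m₂ n₂ l₂) l₂ ++
        segLift (!(d ^^ o₃)) α₃ β₃ m₃ (triangleShift (d ^^ o₃) m₃ n₃ l₃) l₃)) :
    walkCount G (A ++ seg o₁ α₁ β₁ ++ B ++ seg o₂ α₂ β₂ ++ C ++ seg o₃ α₃ β₃ ++ E) =
      walkCount G
        (A ++ seg (!o₁) α₁ β₁ ++ B ++ seg (!o₂) α₂ β₂ ++ C ++ seg (!o₃) α₃ β₃ ++ E) := by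
  refine card_subtype_eq_of_rel (FlipRel A B C o₁ o₂ o₃ α₁ β₁ α₂ β₂ α₃ β₃)
    (exists_flipRel hd (by simpa using hc false)) ?_ (fun _ _ _ => FlipRel.unique)
    (fun _ _ _ h h' => h.symm.unique h'.symm)
  intro y hy
  obtain ⟨x, hx, h⟩ := exists_flipRel (by simpa only [List.mem_append, mem_seg_not] using hd)
    (by simpa using hc true) y hy
  exact ⟨x, by simpa using hx, by simpa using h.symm⟩

lemma perm_three_cases {α : Type*} {a b c x y z : α} (h : [a, b, c].Perm [x, y, z]) :
    (a = x ∧ b = y ∧ c = z) ∨ (a = x ∧ b = z ∧ c = y) ∨ (a = y ∧ b = x ∧ c = z) ∨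
    (a = y ∧ b = z ∧ c = x) ∨ (a = z ∧ b = x ∧ c = y) ∨ (a = z ∧ b = y ∧ c = x) := by
  have h2 : ∀ {b c y z : α}, [b, c].Perm [y, z] → (b = y ∧ c = z) ∨ (b = z ∧ c = y) := by
    intro b c y z h
    have hb : b ∈ [y, z] := h.subset (by simp)
    simp only [List.mem_cons, List.not_mem_nil, or_false] at hb
    rcases hb with rfl | rfl
    · exact .inl ⟨rfl, by simpa using h⟩
    · exact .inr ⟨rfl, by simpa using h.trans (List.Perm.swap _ _ _)⟩
  have ha : a ∈ [x, y, z] := h.subset (by simp)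
  simp only [List.mem_cons, List.not_mem_nil, or_false] at ha
  rcases ha with rfl | rfl | rfl
  · rcases h2 ((List.perm_cons _).1 h) with ⟨rfl, rfl⟩ | ⟨rfl, rfl⟩ <;> simp
  · rcases h2 ((List.perm_cons _).1 (h.trans (List.Perm.swap _ _ _))) with
      ⟨rfl, rfl⟩ | ⟨rfl, rfl⟩ <;> simp
  · have h' : [a, b, c].Perm [a, x, y] :=
      h.trans (List.perm_append_comm (l₁ := [x, y]) (l₂ := [a]))
    rcases h2 ((List.perm_cons a).1 h') with ⟨rfl, rfl⟩ | ⟨rfl, rfl⟩ <;> simp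

lemma walkCount_triangle {A B C E S₁ S₂ S₃ : GaussCode} {x y z : ℕ} {a b c p q r : Bool}
    (h₁ : (q == a) = (r == b)) (h₂ : (p == a) = (r == c))
    (hS : [S₁, S₂, S₃].Perm
      [seg p ⟨x, true, a⟩ ⟨y, true, b⟩, seg q ⟨x, false, a⟩ ⟨z, true, c⟩,
        seg r ⟨y, false, b⟩ ⟨z, false, c⟩])
    (hw : (A ++ S₁ ++ B ++ S₂ ++ C ++ S₃ ++ E).IsValid) :
    walkCount G (A ++ S₁ ++ B ++ S₂ ++ C ++ S₃ ++ E) =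
      walkCount G (A ++ S₁.reverse ++ B ++ S₂.reverse ++ C ++ S₃.reverse ++ E) := by
  classical
  have hrev : ∀ (p : Bool) (a b : Pass), (seg p a b).reverse = seg (!p) a b := by
    intro p a b
    cases p <;> rfl
  have hflat : (S₁ ++ S₂ ++ S₃).Perm (seg p ⟨x, true, a⟩ ⟨y, true, b⟩ ++
      seg q ⟨x, false, a⟩ ⟨z, true, c⟩ ++ seg r ⟨y, false, b⟩ ⟨z, false, c⟩) := by
    simpa using hS.flatten
  have hseg : ∀ (p : Bool) (a b c : Pass), c ∈ seg p a b ↔ c = a ∨ c = b := by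
    intro p a b c
    cases p <;> simp [seg, or_comm]
  have hmem : ∀ u, u ∈ S₁ ++ S₂ ++ S₃ ↔ ((u = ⟨x, true, a⟩ ∨ u = ⟨y, true, b⟩) ∨
      (u = ⟨x, false, a⟩ ∨ u = ⟨z, true, c⟩)) ∨ (u = ⟨y, false, b⟩ ∨ u = ⟨z, false, c⟩) := by
    intro u
    rw [hflat.mem_iff]
    simp only [List.mem_append, hseg]
  have hperm : ((S₁ ++ S₂ ++ S₃) ++ (A ++ B ++ C ++ E)).Perm
      (A ++ S₁ ++ B ++ S₂ ++ C ++ S₃ ++ E) :=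
    List.perm_iff_count.2 fun x => by simp only [List.count_append]; omega
  have hd : ∀ p ∈ S₁ ++ S₂ ++ S₃, ∀ q ∈ A ++ B ++ C ++ E, p.label ≠ q.label := fun p hp q hq =>
    hw.label_ne hperm (by
      intro p hp
      rw [hmem] at hp ⊢
      rcases hp with ((rfl | rfl) | rfl | rfl) | rfl | rfl <;> simp [Pass.swap]) hp hq
  -- The names of the three crossings are distinct: if two coincided, so would their signs, and one
  -- of the over-passages would occur twice.
  have hnd : (S₁ ++ S₂ ++ S₃).Nodup := (hperm.nodup_iff.2 hw.1).of_append_left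
  rw [hflat.nodup_iff] at hnd
  have hsign : ∀ u v : Pass, u ∈ S₁ ++ S₂ ++ S₃ → v ∈ S₁ ++ S₂ ++ S₃ → u.label = v.label →
      u.isPos = v.isPos := fun u v hu hv => hw.2.2 u
    (hperm.subset (List.mem_append_left _ hu)) v (hperm.subset (List.mem_append_left _ hv))
  have hxy : x ≠ y := by
    rintro rfl
    have : a = b := hsign ⟨x, true, a⟩ ⟨x, true, b⟩ (by rw [hmem]; simp) (by rw [hmem]; simp) rfl
    subst this
    cases p <;> simp [seg] at hnd
  have hxz : x ≠ z := by
    rintro rfl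
    have : a = c := hsign ⟨x, true, a⟩ ⟨x, true, c⟩ (by rw [hmem]; simp) (by rw [hmem]; simp) rfl
    subst this
    cases p <;> cases q <;> simp [seg] at hnd
  have hyz : y ≠ z := by
    rintro rfl
    have : b = c := hsign ⟨y, true, b⟩ ⟨y, true, c⟩ (by rw [hmem]; simp) (by rw [hmem]; simp) rfl
    subst this
    cases p <;> cases q <;> simp [seg] at hnd
  have hc : ∀ (d : Bool) (t₀ t₁ t₂ m₀ m₁ m₂ u₀ u₁ u₂ : SidePair G),
      Compatible (segLift (d ^^ p) ⟨x, true, a⟩ ⟨y, true, b⟩ t₀ t₁ t₂ ++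
        segLift (d ^^ q) ⟨x, false, a⟩ ⟨z, true, c⟩ m₀ m₁ m₂ ++
        segLift (d ^^ r) ⟨y, false, b⟩ ⟨z, false, c⟩ u₀ u₁ u₂) →
      Compatible (segLift (!(d ^^ p)) ⟨x, true, a⟩ ⟨y, true, b⟩ t₀
          (triangleShift (d ^^ p) t₀ t₁ t₂) t₂ ++
        segLift (!(d ^^ q)) ⟨x, false, a⟩ ⟨z, true, c⟩ m₀ (triangleShift (d ^^ q) m₀ m₁ m₂) m₂ ++
        segLift (!(d ^^ r)) ⟨y, false, b⟩ ⟨z, false, c⟩ u₀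
          (triangleShift (d ^^ r) u₀ u₁ u₂) u₂) := by
    intro d t₀ t₁ t₂ m₀ m₁ m₂ u₀ u₁ u₂ h
    rw [compatible_triangle hxy hxz hyz] at h ⊢
    refine TriangleRel.shift ?_ ?_ h
    · revert h₁
      cases d <;> cases a <;> cases b <;> cases q <;> cases r <;> simp
    · revert h₂
      cases d <;> cases a <;> cases c <;> cases p <;> cases r <;> simp
  clear hmem hperm hsign hflat
  -- The three strands may be met in any order along the curve. Compatibility depends only on which
  -- colored passages occur, so `hc` covers all six orders.
  rcases perm_three_cases hS with ⟨rfl, rfl, rfl⟩ | ⟨rfl, rfl, rfl⟩ | ⟨rfl, rfl, rfl⟩ |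
    ⟨rfl, rfl, rfl⟩ | ⟨rfl, rfl, rfl⟩ | ⟨rfl, rfl, rfl⟩ <;> rw [hrev, hrev, hrev]
  · exact walkCount_flip hd hc
  · exact walkCount_flip hd fun d _ _ _ _ _ _ _ _ _ h =>
      (hc d _ _ _ _ _ _ _ _ _ (h.of_mem (by simp only [List.mem_append]; tauto))).of_mem
        (by simp only [List.mem_append]; tauto)
  · exact walkCount_flip hd fun d _ _ _ _ _ _ _ _ _ h =>
      (hc d _ _ _ _ _ _ _ _ _ (h.of_mem (by simp only [List.mem_append]; tauto))).of_mem
        (by simp only [List.mem_append]; tauto)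
  · exact walkCount_flip hd fun d _ _ _ _ _ _ _ _ _ h =>
      (hc d _ _ _ _ _ _ _ _ _ (h.of_mem (by simp only [List.mem_append]; tauto))).of_mem
        (by simp only [List.mem_append]; tauto)
  · exact walkCount_flip hd fun d _ _ _ _ _ _ _ _ _ h =>
      (hc d _ _ _ _ _ _ _ _ _ (h.of_mem (by simp only [List.mem_append]; tauto))).of_mem
        (by simp only [List.mem_append]; tauto)
  · exact walkCount_flip hd fun d _ _ _ _ _ _ _ _ _ h =>
      (hc d _ _ _ _ _ _ _ _ _ (h.of_mem (by simp only [List.mem_append]; tauto))).of_mem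
        (by simp only [List.mem_append]; tauto)

lemma Move.walkCount_eq {u v : GaussCode} (h : Move u v) (hu : u.IsValid) (hv : v.IsValid) :
    walkCount G u = walkCount G v := by
  cases h with
  | relabel _ f => exact walkCount_relabel _ f.injective
  | r1 A B k o s => exact walkCount_kink A B k o s hv
  | r2 A B C k l o s d e f he hf h => exact walkCount_bigon A B C k l o s d e f he hf h hu hv
  | r3 A B C E S₁ S₂ S₃ x y z a b c p q r h₁ h₂ hS => exact walkCount_triangle h₁ h₂ hS hu

end Walk

/-! ### Shadow colorings by the dihedral quandle of order three -/

section RegionColoring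

variable {G : Type*} [AddCommGroup G]

/-- The sum of the colors of the two sides is constant along every over-passage. -/
def IsRegionColoring (w : GaussCode) (c : w.Region → G) : Prop :=
  ∀ i : Fin w.length, w[i].isOver = true →
    c (w.region i.castSucc true) + c (w.region i.castSucc false) =
      c (w.region i.succ true) + c (w.region i.succ false)

lemma isPath_ofFn {G : Type*} {n : ℕ} (g : Fin n → Pass) (m : Fin (n + 1) → SidePair G) :
    IsPath (m 0) (List.ofFn fun i => ⟨g i, m i.castSucc, m i.succ⟩) (m (Fin.last n)) := by
  induction n with
  | zero => rfl
  | succ n ih =>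
    rw [List.ofFn_succ]
    exact ⟨rfl, ih (fun i => g i.succ) fun i => m i.succ⟩

lemma edgeColor_ofFn {G : Type*} {n : ℕ} (g : Fin n → Pass) (m : Fin (n + 1) → SidePair G)
    (e : Fin (n + 1)) :
    edgeColor (m 0) (List.ofFn fun i => ⟨g i, m i.castSucc, m i.succ⟩) e = m e := by
  induction n with
  | zero => obtain rfl : e = 0 := Fin.ext (by omega); rfl
  | succ n ih =>
    rw [List.ofFn_succ]
    refine Fin.cases ?_ (fun e => ?_) e
    · rfl
    · exact ih (fun i => g i.succ) (fun i => m i.succ) e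

/-- The colors next to an edge. -/
def sidePair {w : GaussCode} (c : w.Region → G) (e : w.Edge) : SidePair G :=
  (c (w.region e true), c (w.region e false))

/-- The colored walk along the diagram that belongs to a coloring of the regions. -/
def toWalk {w : GaussCode} (c : w.Region → G) : G × List (ColoredPass G) × G :=
  (c (w.region 0 true), List.ofFn fun i : Fin w.length =>
    ⟨w[i], sidePair c i.castSucc, sidePair c i.succ⟩, c (w.region (Fin.last _) true))

lemma sidePair_zero {G : Type*} {w : GaussCode} (c : w.Region → G) :
    sidePair c 0 = (c (w.region 0 true), c (w.region 0 true)) :=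
  Prod.ext rfl (congrArg c (Quot.sound .head).symm)

lemma sidePair_last {G : Type*} {w : GaussCode} (c : w.Region → G) :
    sidePair c (Fin.last _) =
      (c (w.region (Fin.last _) true), c (w.region (Fin.last _) true)) :=
  Prod.ext rfl (congrArg c (Quot.sound .leg).symm)

lemma cornersMatch_of_crosses {G : Type*} {w : GaussCode} (c : w.Region → G) {i j : Fin w.length}
    (h : w.Crosses i j) :
    CornersMatch (sidePair c i.castSucc) (sidePair c i.succ) (sidePair c j.castSucc)
      (sidePair c j.succ) :=
  ⟨congrArg c (Quot.sound (.corner _ _ (.north i j h))),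
    congrArg c (Quot.sound (.corner _ _ (.west i j h))),
    congrArg c (Quot.sound (.corner _ _ (.south i j h))),
    congrArg c (Quot.sound (.corner _ _ (.east i j h)))⟩

lemma isWalk_toWalk {w : GaussCode} (hw : w.IsValid) {c : w.Region → G}
    (hc : IsRegionColoring w c) : IsWalk w (toWalk c) := by
  refine ⟨⟨?_, ?_⟩, ?_⟩
  · have := isPath_ofFn (fun i : Fin w.length => w[i]) (sidePair c)
    rwa [sidePair_zero, sidePair_last] at this
  · refine List.ext_getElem (by simp [toWalk]) fun i h h' => ?_
    simp [toWalk]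
  · intro x hx y hy hl ho hu
    obtain ⟨i, rfl⟩ := List.mem_ofFn.1 hx
    obtain ⟨j, rfl⟩ := List.mem_ofFn.1 hy
    have hs : w[i].isPos = w[j].isPos :=
      hw.2.2 _ (List.getElem_mem i.2) _ (List.getElem_mem j.2) hl
    simp only at hl ho hu ⊢
    refine ⟨hc i ho, ?_⟩
    cases hp : w[i].isPos with
    | true =>
      exact cornersMatch_of_crosses c ⟨hl, by rw [ho, hp], by rw [hu, ← hs, hp]; simp⟩
    | false =>
      exact cornersMatch_of_crosses c ⟨hl.symm, by rw [hu, ← hs, hp], by rw [ho, hp]; simp⟩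

lemma card_regionColoring {w : GaussCode} (hw : w.IsValid) :
    Nat.card {c : w.Region → G // IsRegionColoring w c} = walkCount G w := by
  refine Nat.card_congr (Equiv.ofBijective
    (fun c => ⟨toWalk c.1, isWalk_toWalk hw c.2⟩) ⟨?_, ?_⟩)
  · rintro ⟨c, hc⟩ ⟨c', hc'⟩ h
    have h : toWalk c = toWalk c' := congrArg Subtype.val h
    have key : ∀ c : w.Region → G, ∀ e : w.Edge, edgeColor ((toWalk c).1, (toWalk c).1) (toWalk c).2.1 e =
        sidePair c e := by
      intro c e
      have := edgeColor_ofFn (fun i : Fin w.length => w[i]) (sidePair c) e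
      rwa [sidePair_zero] at this
    refine Subtype.ext (funext ?_)
    rintro ⟨e, s⟩
    have he : sidePair c e = sidePair c' e := by rw [← key, ← key, h]
    cases s
    · exact congrArg Prod.snd he
    · exact congrArg Prod.fst he
  · rintro ⟨⟨a, t, b⟩, hx⟩
    let c : w.Region → G := Quot.lift (fun p : w.Side => (edgeColor (a, a) t p.1).get p.2)
      fun _ _ => get_edgeColor_eq_of_regionRel hw hx
    have hpair : ∀ e, sidePair c e = edgeColor (a, a) t e := fun e => rfl
    have hlen : t.length = w.length := hx.1.length
    have hget : ∀ i (hi : i < w.length), (t[i]'(hlen ▸ hi)).pass = w[i] := by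
      have := hx.1.2
      intro i hi
      simp only at this
      simp [← this]
    have hc : IsRegionColoring w c := by
      intro i hi
      -- Compatibility speaks about pairs of passages; validity provides the under-passage that
      -- belongs to the over-passage `i`.
      obtain ⟨j, hj, hji⟩ := List.getElem_of_mem (hw.2.1 w[i] (List.getElem_mem _))
      have hi' : i.1 < t.length := by rw [hlen]; exact i.2
      have hj' : j < t.length := by rw [hlen]; exact hj
      have h := (hx.2 _ (List.getElem_mem hi') _ (List.getElem_mem hj')
        (by rw [hget _ i.2, hget _ hj, hji]; rfl) (by rw [hget _ i.2]; exact hi)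
        (by rw [hget _ hj, hji]; simpa [Pass.swap] using hi)).1
      obtain ⟨e₁, e₂⟩ := hx.1.1.getElem i.1 hi'
      simp only at h e₁ e₂
      rw [e₁, e₂] at h
      exact h
    refine ⟨⟨c, hc⟩, Subtype.ext (Prod.ext ?_ (Prod.ext ?_ ?_))⟩
    · show (edgeColor (a, a) t 0).1 = a
      cases t <;> rfl
    · refine List.ext_getElem (by simp [toWalk, hlen]) fun i h h' => ?_
      obtain ⟨e₁, e₂⟩ := hx.1.1.getElem i h'
      have e₃ := hget i (by simpa [toWalk] using h)
      simp only at e₁ e₂ h'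
      simp only [toWalk, List.getElem_ofFn, hpair]
      rw [Fin.getElem_fin, ← e₃]
      simp only [Fin.val_castSucc, Fin.val_succ]
      rw [← e₁, ← e₂]
    · show (edgeColor (a, a) t w.length).1 = b
      have := hx.1.1.edgeColor_last
      simp only [hlen] at this
      rw [this]

end RegionColoring

/-! ### Elimination of the arc colors modulo 3. -/

lemma dihedral_three_act (x y : ZMod 3) :
    (Shelf.act (α := Quandle.Dihedral 3) x y : ZMod 3) = -(x + y) := by
  change 2 * x - y = -(x + y)
  have : (3 : ZMod 3) = 0 := rfl
  linear_combination x * this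

/-- With region colors north, west, south, east, the sum condition is `W + S = N + E`. The negated
arc colors are `W + S`, `S + E`, `W + N`, and they add up to `3 * (W + S) = 0`. -/
lemma underColor_pos {i i' j j' : SidePair (ZMod 3)} (h : CornersMatch i i' j j')
    (hi : i.1 + i.2 = i'.1 + i'.2) :
    -(j'.1 + j'.2) = -(-(i.1 + i.2) + -(j.1 + j.2)) := by
  obtain ⟨h₁, h₂, h₃, h₄⟩ := h
  have three : (3 : ZMod 3) = 0 := rfl
  linear_combination h₁ - h₂ + h₃ - h₄ + hi - (i.1 + i.2) * three

/-- The same computation with the over-strand going from south-east to north-west; the total is `3 *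
(S + E)`. -/
lemma underColor_neg {i i' j j' : SidePair (ZMod 3)} (h : CornersMatch j j' i i')
    (hi : i.1 + i.2 = i'.1 + i'.2) :
    -(j.1 + j.2) = -(-(i.1 + i.2) + -(j'.1 + j'.2)) := by
  obtain ⟨h₁, h₂, h₃, h₄⟩ := h
  have three : (3 : ZMod 3) = 0 := rfl
  linear_combination -h₁ + h₂ - h₃ + h₄ + hi - (i.1 + i.2) * three

lemma arcColor_eq {x y a : ZMod 3} (h : x = -(a + y)) : a = -(x + y) := by
  rw [h]; ring

end GaussCode

namespace KnotoidDiagram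

open GaussCode

lemma Coloring.region_left {D : KnotoidDiagram}
    (c : D.Coloring (Quandle.Dihedral 3) (Quandle.Dihedral 3)) (e : D.code.Edge) :
    (c.arc (D.code.arc e) : ZMod 3) =
      -((sidePair (G := ZMod 3) c.region e).1 + (sidePair (G := ZMod 3) c.region e).2) :=
  arcColor_eq ((c.side e).trans (dihedral_three_act _ _))

/-- Shadow colorings by the dihedral quandle of order three are colorings of the regions. -/
lemma col_eq_walkCount (D : KnotoidDiagram) :
    D.col (Quandle.Dihedral 3) (Quandle.Dihedral 3) = walkCount (ZMod 3) D.code := by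
  rw [← card_regionColoring D.valid]
  refine Nat.card_congr (Equiv.ofBijective (fun c =>
    (⟨c.region, ?_⟩ : {r : D.code.Region → ZMod 3 // IsRegionColoring D.code r})) ⟨?_, ?_⟩)
  · intro i hi
    have h₁ := c.region_left i.castSucc
    have h₂ := c.region_left i.succ
    rw [show D.code.arc i.succ = D.code.arc i.castSucc from (Quot.sound (.overpass i hi)).symm,
      h₁] at h₂
    exact neg_injective h₂
  · intro c c' h
    have h : c.region = c'.region := congrArg Subtype.val h
    refine Coloring.ext (funext ?_) h
    rintro ⟨e⟩
    exact (c.region_left e).trans ((by rw [h] : _ = _).trans (c'.region_left e).symm)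
  · rintro ⟨r, hr⟩
    let f : D.code.Edge → ZMod 3 := fun e =>
      -(r (D.code.region e true) + r (D.code.region e false))
    -- Constancy of the sum along over-passages is exactly what lets the edge colors descend to the
    -- arcs.
    have hf : ∀ a b, D.code.ArcRel a b → f a = f b := by
      rintro a b ⟨i, hi⟩
      exact congrArg Neg.neg (hr i hi)
    refine ⟨⟨Quot.lift f hf, r, fun i j hl ho hu => ?_, fun e => ?_⟩, rfl⟩
    · have hs : D.code[i].isPos = D.code[j].isPos :=
        D.valid.2.2 _ (List.getElem_mem i.2) _ (List.getElem_mem j.2) hl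
      split_ifs with hp
      · have h := cornersMatch_of_crosses r
          (⟨hl, by rw [ho, hp], by rw [hu, ← hs, hp]; simp⟩ : D.code.Crosses i j)
        refine Eq.trans ?_ (dihedral_three_act (f i.castSucc) (f j.castSucc)).symm
        exact underColor_pos h (hr i ho)
      · have hp : D.code[i].isPos = false := by simpa using hp
        have h := cornersMatch_of_crosses r
          (⟨hl.symm, by rw [hu, ← hs, hp], by rw [ho, hp]; simp⟩ : D.code.Crosses j i)
        refine Eq.trans ?_ (dihedral_three_act (f i.castSucc) (f j.succ)).symm
        exact underColor_neg h (hr i ho)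
    · refine Eq.trans ?_ (dihedral_three_act (f e) (r (D.code.region e false))).symm
      exact arcColor_eq rfl

lemma walkCount_eq_of_mk_eq {G : Type*} [AddCommGroup G] {D D' : KnotoidDiagram}
    (h : Knotoid.mk D = Knotoid.mk D') : walkCount G D.code = walkCount G D'.code := by
  have hDD' : Relation.EqvGen (fun D D' : KnotoidDiagram => GaussCode.Move D.code D'.code) D D' :=
    Quotient.exact h
  clear h
  induction hDD' with
  | rel D D' h => exact h.walkCount_eq D.valid D'.valid
  | refl => rfl
  | symm _ _ _ ih => exact ih.symm
  | trans _ _ _ _ _ ih₁ ih₂ => exact ih₁.trans ih₂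

end KnotoidDiagram

namespace GaussCode

/-! ### Colorings of products and of the knotoid `2₁` -/

/-! ### Gluing colorings along the joining edge of a product. -/

section Product

variable {G : Type*} [AddCommGroup G]

lemma walkCount_nil : walkCount G [] = Nat.card G := by
  symm
  refine Nat.card_congr (Equiv.ofBijective
    (fun a => ⟨(a, [], a), ⟨⟨rfl, rfl⟩, by simp [Compatible]⟩⟩) ⟨?_, ?_⟩)
  · intro a b h
    exact congrArg (fun x => x.1.1) h
  · rintro ⟨⟨a, t, b⟩, ⟨h, ht⟩, -⟩
    obtain rfl : t = [] := by simpa using ht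
    obtain rfl : a = b := congrArg Prod.fst h
    exact ⟨a, rfl⟩

/-- If the colorings of `v` with a given color at the head are parametrized by `ι`, then a product with
`v` has `card ι` times as many colorings. -/
lemma walkCount_mul {u v : GaussCode} (hu : u.IsValid) (hv : v.IsValid) {ι : Type*}
    (hι : ∀ a : G, Nonempty
      ({y : List (ColoredPass G) × G // IsWalk (v.map (Pass.relabel fun k => 2 * k + 1)) (a, y)} ≃ ι)) :
    walkCount G (u.mul v) = walkCount G u * Nat.card ι := by
  -- The product contains the renamed copy of `u`, so `u` is renamed in the count as well.
  rw [walkCount_relabel u (f := fun k => 2 * k) fun a b h => by simpa using h, walkCount,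
    walkCount, ← Nat.card_prod]
  set u' := u.map (Pass.relabel fun k => 2 * k) with hu'
  set v' := v.map (Pass.relabel fun k => 2 * k + 1) with hv'
  have huv : u.mul v = u' ++ v' := rfl
  have hlen : u'.length = u.length := by simp [hu']
  have hc : ∀ {s t : List (ColoredPass G)}, s.map ColoredPass.pass = u' →
      t.map ColoredPass.pass = v' → (Compatible (s ++ t) ↔ Compatible s ∧ Compatible t) := by
    intro s t hs ht
    refine compatible_of_disjoint (fun x => List.mem_append) fun x hx y hy h => ?_
    have hx' : x.pass ∈ u' := hs ▸ List.mem_map_of_mem hx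
    have hy' : y.pass ∈ v' := ht ▸ List.mem_map_of_mem hy
    obtain ⟨p, -, hp⟩ := List.mem_map.1 hx'
    obtain ⟨q, -, hq⟩ := List.mem_map.1 hy'
    rw [← hp, ← hq] at h
    simp only [Pass.relabel] at h
    omega
  have e := fun a => (hι a).some
  -- By `mul_joint` the joining edge has the same region on both sides. The first part of a walk
  -- therefore ends, and the second starts, with a pair of equal colors, as at a leg and a head.
  have hmid : ∀ {a b : G} {m : SidePair G} {s t : List (ColoredPass G)}, IsLift u' (a, a) m s →
      IsWalk (u.mul v) (a, s ++ t, b) → m = (m.1, m.1) := by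
    intro a b m s t hs hx
    have := get_edgeColor_eq_of_region (hu.mul hv) hx
      (e := ⟨u.length, by simp [mul_length]⟩)
      (f := ⟨u.length, by simp [mul_length]⟩) (s := true) (s' := false) (by
        have h := mul_joint (v := v) hu
        simp only [Emb.side, Fin.val_last, zero_add] at h
        exact h)
    simp only at this
    rw [← hlen, ← hs.length, edgeColor_length hs.1] at this
    exact Prod.ext rfl this.symm
  let F : (Σ x : {x : G × List (ColoredPass G) × G // IsWalk u' x},
      {y : List (ColoredPass G) × G // IsWalk v' (x.1.2.2, y)}) →
      {x : G × List (ColoredPass G) × G // IsWalk (u.mul v) x} := fun x =>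
    ⟨(x.1.1.1, x.1.1.2.1 ++ x.2.1.1, x.2.1.2), ⟨x.1.2.1.append x.2.2.1,
      (hc x.1.2.1.2 x.2.2.1.2).2 ⟨x.1.2.2, x.2.2.2⟩⟩⟩
  refine Nat.card_congr ((Equiv.ofBijective F ⟨?_, ?_⟩).symm.trans
    ((Equiv.sigmaCongrRight fun x : {x : G × List (ColoredPass G) × G // IsWalk u' x} =>
      e x.1.2.2).trans (Equiv.sigmaEquivProd _ _)))
  · rintro ⟨⟨⟨a, s, b⟩, hs⟩, ⟨⟨t, d⟩, ht⟩⟩ ⟨⟨⟨a', s', b'⟩, hs'⟩, ⟨⟨t', d'⟩, ht'⟩⟩ h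
    have h : (a, s ++ t, d) = (a', s' ++ t', d') := congrArg Subtype.val h
    simp only [Prod.mk.injEq] at h
    obtain ⟨rfl, hst, rfl⟩ := h
    obtain ⟨rfl, rfl⟩ := List.append_inj hst (hs.1.length.trans hs'.1.length.symm)
    obtain rfl : b = b' := congrArg Prod.fst (isPath_unique hs.1.1 hs'.1.1)
    rfl
  · rintro ⟨⟨a, t, d⟩, hx⟩
    have hx' := hx
    obtain ⟨hl, hcomp⟩ := hx'
    obtain ⟨m, s, t, rfl, hs, ht⟩ := isLift_append.1 (huv ▸ hl)
    obtain ⟨hcs, hct⟩ := (hc hs.2 ht.2).1 hcomp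
    have hm := hmid hs hx
    rw [hm] at hs ht
    exact ⟨⟨⟨(a, s, m.1), hs, hcs⟩, ⟨(t, d), ht, hct⟩⟩, rfl⟩

end Product

/-! ### Colorings of `2₁` and of its mirror image. -/

section Bifoil

variable {G : Type*} [AddCommGroup G]

/-- The code of the knotoid `2₁` or of its mirror image, with names `k`, `l` of the crossings. -/
def bifoilCode (k l : ℕ) (o s : Bool) : GaussCode :=
  [⟨k, o, s⟩, ⟨l, !o, s⟩, ⟨k, !o, s⟩, ⟨l, o, s⟩]

/-- The colored passages along `bifoilCode k l o s`. -/
def bifoilLift {G : Type*} (k l : ℕ) (o s : Bool) (m₀ m₁ m₂ m₃ m₄ : SidePair G) :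
    List (ColoredPass G) :=
  [⟨⟨k, o, s⟩, m₀, m₁⟩, ⟨⟨l, !o, s⟩, m₁, m₂⟩, ⟨⟨k, !o, s⟩, m₂, m₃⟩, ⟨⟨l, o, s⟩, m₃, m₄⟩]

lemma isLift_cons {G : Type*} {p : Pass} {w : GaussCode} {a b : SidePair G}
    {t : List (ColoredPass G)} :
    IsLift (p :: w) a b t ↔ ∃ n s, t = ⟨p, a, n⟩ :: s ∧ IsLift w n b s := by
  constructor
  · rintro ⟨h, h'⟩
    obtain ⟨⟨x, c, n⟩, s, rfl, rfl, hs⟩ := List.map_eq_cons_iff.1 h'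
    obtain ⟨rfl, h⟩ := h
    exact ⟨n, s, rfl, h, hs⟩
  · rintro ⟨n, s, rfl, h, h'⟩
    exact ⟨⟨rfl, h⟩, by simp [h']⟩

lemma isLift_nil {G : Type*} {a b : SidePair G} {t : List (ColoredPass G)} :
    IsLift [] a b t ↔ t = [] ∧ a = b := by
  constructor
  · rintro ⟨h, h'⟩
    obtain rfl := List.map_eq_nil_iff.1 h'
    exact ⟨rfl, h⟩
  · rintro ⟨rfl, h⟩
    exact ⟨h, rfl⟩

lemma compatible_bifoilLift {k l : ℕ} (hkl : k ≠ l) {o s : Bool} {m₀ m₁ m₂ m₃ m₄ : SidePair G} :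
    Compatible (bifoilLift k l o s m₀ m₁ m₂ m₃ m₄) ↔
      StrandRel o s m₀ m₁ m₂ m₃ ∧ StrandRel (!o) s m₁ m₂ m₃ m₄ := by
  cases o <;> simp [Compatible, bifoilLift, StrandRel, hkl, hkl.symm]
  tauto

/-- The corners leave three region colors `a`, `b`, `c`. For `o = false` the over-passages are the
two inner ones, so the sum is the same for `m₁`, `m₂`, `m₃`. For `o = true` they are the outer ones,
which compares `(a, a)` with `m₁` and `m₃` with `(b, b)`. This is the source of the difference
between `2₁` and its mirror. -/
lemma strandRel_bifoil {o s : Bool} {a b : G} {m₁ m₂ m₃ : SidePair G} :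
    (StrandRel o s (a, a) m₁ m₂ m₃ ∧ StrandRel (!o) s m₁ m₂ m₃ (b, b)) ↔
      ∃ c : G, m₁ = SidePair.mk (o != s) b c ∧ m₂ = SidePair.mk (o != s) b a ∧
        m₃ = SidePair.mk (o != s) c a ∧
        if o then a + a = b + c ∧ a + c = b + b else c = a ∧ b = a := by
  obtain ⟨m₁₁, m₁₂⟩ := m₁
  obtain ⟨m₂₁, m₂₂⟩ := m₂
  obtain ⟨m₃₁, m₃₂⟩ := m₃
  constructor
  · intro h
    -- The second edge has the leg region on side `o != s`, hence the third region on the other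
    -- side.
    refine ⟨SidePair.get (m₁₁, m₁₂) (!(o != s)), ?_⟩
    revert h
    cases o <;> cases s <;>
      simp [StrandRel, CrossingRel, CornersMatch, SidePair.mk, SidePair.get] <;> grind
  · rintro ⟨c, h⟩
    revert h
    cases o <;> cases s <;>
      simp [StrandRel, CrossingRel, CornersMatch, SidePair.mk] <;> grind

/-- The colors of the regions of `bifoilCode k l o s` are `a` (at the head), `b` (at the leg) and `c`. -/
lemma isWalk_bifoilCode {k l : ℕ} (hkl : k ≠ l) {o s : Bool} {a : G}
    {y : List (ColoredPass G) × G} :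
    IsWalk (bifoilCode k l o s) (a, y) ↔ ∃ c b : G,
      (if o then a + a = b + c ∧ a + c = b + b else c = a ∧ b = a) ∧
      y = (bifoilLift k l o s (a, a) (SidePair.mk (o != s) b c) (SidePair.mk (o != s) b a)
        (SidePair.mk (o != s) c a) (b, b), b) := by
  obtain ⟨t, b⟩ := y
  constructor
  · rintro ⟨hl, hc⟩
    simp only at hl hc
    obtain ⟨m₁, t₁, rfl, hl₁⟩ := isLift_cons.1 hl
    obtain ⟨m₂, t₂, rfl, hl₂⟩ := isLift_cons.1 hl₁
    obtain ⟨m₃, t₃, rfl, hl₃⟩ := isLift_cons.1 hl₂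
    obtain ⟨m₄, t₄, rfl, hl₄⟩ := isLift_cons.1 hl₃
    obtain ⟨rfl, rfl⟩ := isLift_nil.1 hl₄
    obtain ⟨c, rfl, rfl, rfl, h⟩ := strandRel_bifoil.1 ((compatible_bifoilLift hkl).1 hc)
    exact ⟨c, b, h, rfl⟩
  · rintro ⟨c, b, h, e⟩
    obtain ⟨rfl, rfl⟩ := Prod.mk.inj e
    refine ⟨⟨⟨rfl, rfl, rfl, rfl, rfl⟩, rfl⟩, (compatible_bifoilLift hkl).2 ?_⟩
    exact strandRel_bifoil.2 ⟨c, rfl, rfl, rfl, h⟩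

/-- All regions have the head color, over any group. -/
lemma bifoil_walks {k l : ℕ} (hkl : k ≠ l) (s : Bool) (a : G) : Nonempty
    ({y : List (ColoredPass G) × G // IsWalk (bifoilCode k l false s) (a, y)} ≃ Unit) := by
  simp only [isWalk_bifoilCode hkl, Bool.false_eq_true, if_false]
  refine ⟨⟨fun _ => (), fun _ => ⟨_, a, a, ⟨rfl, rfl⟩, rfl⟩, ?_, fun _ => rfl⟩⟩
  rintro ⟨_, c, b, ⟨rfl, rfl⟩, rfl⟩
  rfl

/-- The leg color `b` is a free parameter: the first equation gives `c = a + a - b`, and the second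
then becomes `3 * (a - b) = 0`. -/
lemma mirror_bifoil_walks {k l : ℕ} (hkl : k ≠ l) (s : Bool) (a : ZMod 3) : Nonempty
    ({y : List (ColoredPass (ZMod 3)) × ZMod 3 // IsWalk (bifoilCode k l true s) (a, y)} ≃
      ZMod 3) := by
  simp only [isWalk_bifoilCode hkl, if_true]
  have hb : ∀ b, a + a = b + (a + a - b) ∧ a + (a + a - b) = b + b := by
    intro b
    have three : (3 : ZMod 3) = 0 := rfl
    exact ⟨by ring, by linear_combination (a - b) * three⟩
  refine ⟨(Equiv.ofBijective (fun b => ⟨_, a + a - b, b, hb b, rfl⟩) ⟨?_, ?_⟩).symm⟩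
  · intro b b' h
    exact congrArg (fun y => y.1.2) h
  · rintro ⟨_, c, b, ⟨h, h'⟩, rfl⟩
    obtain rfl : c = a + a - b := by rw [h]; ring
    exact ⟨b, rfl⟩

end Bifoil

lemma walkCount_mul_bifoil {G : Type*} [AddCommGroup G] {u : GaussCode} (hu : u.IsValid)
    (s : Bool) : walkCount G (u.mul (bifoil s)) = walkCount G u := by
  rw [walkCount_mul hu (bifoil_valid s) fun a =>
    -- As a second factor, the crossings `0` and `1` are renamed to `2 * 0 + 1` and `2 * 1 + 1`.
    bifoil_walks (k := 1) (l := 3) (by omega) s a, Nat.card_unique, mul_one]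

lemma walkCount_mul_mirror_bifoil {u : GaussCode} (hu : u.IsValid) (s : Bool) :
    walkCount (ZMod 3) (u.mul (bifoil s).mirror) = walkCount (ZMod 3) u * 3 := by
  rw [walkCount_mul hu (bifoil_valid s).mirror fun a =>
    -- Switching the crossings also changes their sign, hence `!s`.
    mirror_bifoil_walks (k := 1) (l := 3) (by omega) (!s) a, Nat.card_zmod]

lemma mirror_mul (u v : GaussCode) : (u.mul v).mirror = u.mirror.mul v.mirror := by
  simp [mirror, mul, Pass.mirror, Pass.relabel, Function.comp_def]

end GaussCode

/-! ### Powers of `2₁` and their mirrors. -/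

namespace Knotoid

open GaussCode

lemma mk_surjective : Function.Surjective mk := Quotient.mk_surjective

lemma mirror_mul (κ κ' : Knotoid) : (κ.mul κ').mirror = κ.mirror.mul κ'.mirror := by
  obtain ⟨D, rfl⟩ := mk_surjective κ
  obtain ⟨D', rfl⟩ := mk_surjective κ'
  have : (D.mul D').mirror = D.mirror.mul D'.mirror := by
    simp only [KnotoidDiagram.mirror, KnotoidDiagram.mul, GaussCode.mirror_mul]
  exact congrArg mk this

lemma mirror_pow (κ : Knotoid) (n : ℕ) : (κ.pow n).mirror = κ.mirror.pow n := by
  induction n with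
  | zero => rfl
  | succ n ih => rw [pow, pow, mirror_mul, ih]

lemma walkCount_of_mk_eq_pow_bifoil {G : Type*} [AddCommGroup G] (s : Bool) (n : ℕ)
    (D : KnotoidDiagram) (hD : mk D = (bifoil s).pow n) :
    walkCount G D.code = Nat.card G := by
  induction n generalizing D with
  | zero =>
    rw [KnotoidDiagram.walkCount_eq_of_mk_eq hD]
    exact walkCount_nil
  | succ n ih =>
    -- By invariance the count may be taken on the product of any diagram `E` of the smaller power
    -- with the standard diagram.
    obtain ⟨E, hE⟩ := mk_surjective ((bifoil s).pow n)
    rw [pow, ← hE] at hD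
    rw [KnotoidDiagram.walkCount_eq_of_mk_eq (hD.trans rfl : mk D = mk (E.mul _))]
    exact (walkCount_mul_bifoil E.valid s).trans (ih E hE)

lemma walkCount_of_mk_eq_pow_mirror_bifoil (s : Bool) (n : ℕ) (D : KnotoidDiagram)
    (hD : mk D = (bifoil s).mirror.pow n) : walkCount (ZMod 3) D.code = 3 ^ (n + 1) := by
  induction n generalizing D with
  | zero =>
    rw [KnotoidDiagram.walkCount_eq_of_mk_eq hD]
    exact walkCount_nil.trans (Nat.card_zmod 3)
  | succ n ih =>
    obtain ⟨E, hE⟩ := mk_surjective ((bifoil s).mirror.pow n)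
    rw [pow, ← hE] at hD
    rw [KnotoidDiagram.walkCount_eq_of_mk_eq (hD.trans rfl : mk D = mk (E.mul _)), pow_succ,
      ← ih E hE]
    exact walkCount_mul_mirror_bifoil E.valid s

/-- The powers of `2₁` are distinguished by the coloring numbers of their mirror images. -/
lemma pow_bifoil_injective (s : Bool) : Function.Injective fun n : ℕ => (bifoil s).pow n := by
  intro n m h
  obtain ⟨D, hD⟩ := mk_surjective ((bifoil s).mirror.pow n)
  have h' : mk D = (bifoil s).mirror.pow m := by
    -- Equal powers have equal mirrors, and the counts of the mirrors depend injectively on the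
    -- exponent.
    rw [hD, ← mirror_pow, ← mirror_pow]
    exact congrArg mirror h
  have := (walkCount_of_mk_eq_pow_mirror_bifoil s n D hD).symm.trans
    (walkCount_of_mk_eq_pow_mirror_bifoil s m D h')
  exact Nat.succ_injective (Nat.pow_right_injective (by omega : 2 ≤ 3) this)

end Knotoid

theorem theorem3p1 :
    {κ : Knotoid | ∃ m m' : ℕ, m ≠ m' ∧
      (∀ D, Knotoid.mk D = κ → D.col (Quandle.Dihedral 3) (Quandle.Dihedral 3) = m) ∧
      (∀ D, Knotoid.mk D = κ.mirror →
        D.col (Quandle.Dihedral 3) (Quandle.Dihedral 3) = m')}.Infinite ∧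
    ∀ s : Bool,
      (∀ (n : ℕ) (D : KnotoidDiagram), Knotoid.mk D = (Knotoid.bifoil s).pow n →
        D.col (Quandle.Dihedral 3) (Quandle.Dihedral 3) = 3) ∧
      (∀ (n : ℕ) (D : KnotoidDiagram), Knotoid.mk D = (Knotoid.bifoil s).mirror.pow n →
        D.col (Quandle.Dihedral 3) (Quandle.Dihedral 3) = 3 ^ (n + 1)) ∧
      (∀ n : ℕ, ((Knotoid.bifoil s).pow n).mirror = (Knotoid.bifoil s).mirror.pow n) ∧
      (∀ n : ℕ, 1 ≤ n → (Knotoid.bifoil s).pow n ≠ ((Knotoid.bifoil s).pow n).mirror) ∧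
      Function.Injective (fun n : ℕ => (Knotoid.bifoil s).pow n) := by
  have h₁ : ∀ s n D, Knotoid.mk D = (Knotoid.bifoil s).pow n →
      D.col (Quandle.Dihedral 3) (Quandle.Dihedral 3) = 3 := fun s n D hD => by
    rw [D.col_eq_walkCount, Knotoid.walkCount_of_mk_eq_pow_bifoil s n D hD, Nat.card_zmod]
  have h₂ : ∀ s n D, Knotoid.mk D = (Knotoid.bifoil s).mirror.pow n →
      D.col (Quandle.Dihedral 3) (Quandle.Dihedral 3) = 3 ^ (n + 1) := fun s n D hD => by
    rw [D.col_eq_walkCount, Knotoid.walkCount_of_mk_eq_pow_mirror_bifoil s n D hD]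
  have hne : ∀ n : ℕ, 1 ≤ n → 3 ≠ 3 ^ (n + 1) := fun n hn h => by
    have := Nat.pow_right_injective (by omega : 2 ≤ 3) ((pow_one 3).trans h)
    omega
  refine ⟨?_, fun s => ⟨h₁ s, h₂ s, Knotoid.mirror_pow _, fun n hn h => ?_,
    Knotoid.pow_bifoil_injective s⟩⟩
  -- The exponents start at 1, because for the trivial knotoid both counts are 3.
  · refine Set.infinite_of_injective_forall_mem
      (f := fun n : ℕ => (Knotoid.bifoil true).pow (n + 1))
      (fun n m h => Nat.succ_injective (Knotoid.pow_bifoil_injective true h)) fun n => ?_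
    exact ⟨3, 3 ^ (n + 1 + 1), hne _ (by omega), h₁ true _,
      fun D hD => h₂ true _ D (hD.trans (Knotoid.mirror_pow _ _))⟩
  · obtain ⟨D, hD⟩ := Knotoid.mk_surjective ((Knotoid.bifoil s).pow n)
    exact hne n hn ((h₁ s n D hD).symm.trans
      (h₂ s n D (hD.trans (h.trans (Knotoid.mirror_pow _ _)))))
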